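/- All vector spaces are over $\mathbb{C}$, and $\binom{n}{i}$ is the generalized binomial coefficient for $n\in\mathbb{Z}$, $i\in\mathbb{N}$. **Setting.** Let $(V,Y,\mathbf 1)$ be an $\mathbb{N}$-graded vertex algebra, that is, a vertex algebra with a grading $V=\coprod_{n\in\mathbb{Z}}V_{(n)}$ such that $V_{(n)}=0$ for $n<0$ and $[d,Y(u,x)]=x\frac{d}{dx}Y(u,x)+Y(du,x)$ for $u\in V$, where $du=nu$ for $u\in V_{(n)}$. Write $Y(u,x)=\sum_{n\in\mathbb{Z}}u_nx^{-n-1}$, and $\operatorname{wt}u=n$ for $u\in V_{(n)}$. A module for the vertex algebra $V$ is a vector space $W$ with a linear map $Y_W:V\otimes W\to W((x))$ such that $Y_W(\mathbf 1,x)=1_W$ and the Jacobi identity holds. An $\mathbb{N}$-gradable weak $V$-module is such a module $W$ with a grading $W=\coprod_{n\in\mathbb{N}}W_{(n)}$ such that, for $u\in V_{(m)}$ and $n\in\mathbb{Z}$, the operator $u_n=\operatorname{Res}_xx^nY_W(u,x)$ maps $W_{(k)}$ to $W_{(k+m-n-1)}$ (where $W_{(j)}=0$ for $j<0$). Zhu's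 algebra is $A(V)=V/O(V)$, where $O(V)$ is the span of the elements $\operatorname{Res}_xx^nY((x+1)^{L(0)}u,x)v$ for $u,v\in V$, $n\le-2$, with the multiplication induced by $u*v=\operatorname{Res}_xx^{-1}Y((x+1)^{L(0)}u,x)v$ and the unit $\mathbf 1+O(V)$; here $L(0)$ acts on $V_{(m)}$ as $m$. Let $M$ be an $A(V)$-module, with representation $\rho:A(V)\to\operatorname{End}M$. **Construction.** Let $T=T(V[t,t^{-1}])$ be the tensor algebra of $V[t,t^{-1}]=V\otimes\mathbb{C}[t,t^{-1}]$, and write $u(m)=u\otimes t^m$. The algebra $T$ acts from the left on $T\otimes M$, which is $\mathbb{Z}$-graded by giving $u_1(m_1)\cdots u_k(m_k)w$, for $u_i$ homogeneous and $w\in M$, the degree $\sum_i(\operatorname{wt}u_i-m_i-1)$. Let $o_t(u)=u(\operatorname{wt}u-1)$ for homogeneous $u$, extended linearly to $V$, and let $Y_t(u,x)=\sum_{m\in\mathbb{Z}}u(m)x^{-m-1}$. Let $\mathcal I\subseteq T\otimes M$ be the $T$-submodule generated by the following elements: 1. $u(m)w$ for homogeneous $u\in V$ and $w\in T\otimes M$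 with $\operatorname{wt}u-m-1+\deg w<0$; 2. $o_t(u)w-\rho(u+O(V))w$ for $u\in V$, $w\in M$; 3. for homogeneous $u,v\in V$, $w\in T\otimes M$ and $p,q\in\mathbb{Z}$ with $k>q$ and $\operatorname{wt}u-p-1+\operatorname{wt}v-q-1+\deg w\ge0$, where $l=\operatorname{wt}u+\deg w$ and $k=\operatorname{wt}v+\deg w$, $$u(p)v(q)w-\sum_{i=0}^{k-q-1}\sum_{j=0}^{l}\binom{p-l}{i}\binom{l}{j}(u_{p-l-i+j}v)(q+l+i-j)w.$$ Let $S_1(M)=(T\otimes M)/\mathcal I$, with the induced degrees. Let $\mathcal J\subseteq S_1(M)$ be the $T$-submodule generated by the elements $$\sum_{j=0}^{l}\binom{l}{j}(u_{p-l-i+j}v)(q+i+l-j)w$$ for homogeneous $u,v\in V$, $w\in S_1(M)$ and $p,q,i\in\mathbb{Z}$ with $i\ge\operatorname{wt}v+\deg w-q$, where $l=\operatorname{wt}u+\deg w$. (In both cases a sum $\sum_{j=0}^{l}$ with $l<0$ is empty.) Let $S(M)=S_1(M)/\mathcal J$. No relations corresponding to the commutator formula are imposed. **Theorem.** The formula $Y_{S(M)}(u,x)w=\sum_{m\in\mathbb{Z}}(u(m)w)\,x^{-m-1}$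 induced by $Y_t$ defines a linear map $Y_{S(M)}:V\otimes S(M)\to S(M)((x))$, and $(S(M),Y_{S(M)})$, with the subspaces $S(M)_{(n)}$, $n\in\mathbb{N}$, of elements of degree $n$, is an $\mathbb{N}$-gradable weak $V$-module. In particular, $S(M)=\coprod_{n\in\mathbb{N}}S(M)_{(n)}$. -/

import Mathlib

open scoped TensorProduct

noncomputable section

namespace VA

/-! ### Vertex algebras and their modules

`VertexOperator ℂ W` is Mathlib's type of linear maps `W → W((x))`, and
`VertexOperator.ncoeff A n` is the coefficient of `x ^ (-n-1)` in `A`. -/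

section Modules

variable {V : Type*} [AddCommGroup V] [Module ℂ V]
variable {W : Type*} [AddCommGroup W] [Module ℂ W]

/-- The operator `u_n = Res_x x^n Y(u, x)` on `W`. -/
def mode (Y : V →ₗ[ℂ] VertexOperator ℂ W) (u : V) (n : ℤ) : Module.End ℂ W :=
  VertexOperator.ncoeff (Y u) n

/-- The Jacobi identity
`x₀⁻¹δ((x₁-x₂)/x₀) Y_W(u,x₁)Y_W(v,x₂)w - x₀⁻¹δ((x₂-x₁)/(-x₀)) Y_W(v,x₂)Y_W(u,x₁)w`
`= x₂⁻¹δ((x₁-x₀)/x₂) Y_W(Y(u,x₀)v,x₂)w`,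
written out for the coefficient of `x₀ ^ (-l-1) x₁ ^ (-m-1) x₂ ^ (-n-1)`.  All the sums
have only finitely many nonzero terms, because the vertex operators are lower truncated. -/
def JacobiIdentity (Y : V →ₗ[ℂ] VertexOperator ℂ V) (YW : V →ₗ[ℂ] VertexOperator ℂ W) : Prop :=
  ∀ (u v : V) (w : W) (l m n : ℤ),
    (∑ᶠ i : ℕ, ((-1) ^ i * Ring.choose l i) •
        mode YW u (m + l - i) (mode YW v (n + i) w))
      - (∑ᶠ i : ℕ, ((Int.negOnePow l : ℤ) * (-1) ^ i * Ring.choose l i) •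
        mode YW v (n + l - i) (mode YW u (m + i) w))
      = ∑ᶠ i : ℕ, Ring.choose m i • mode YW (mode Y u (l + i) v) (m + n - i) w

end Modules

/-- A vertex algebra `(V, Y, 𝟏)` over `ℂ`.  Lower truncation is part of the type of `Y`. -/
structure VertexAlgebra (V : Type*) [AddCommGroup V] [Module ℂ V] where
  /-- the vertex operator map -/
  Y : V →ₗ[ℂ] VertexOperator ℂ V
  /-- the vacuum vector -/
  vac : V
  /-- `Y(𝟏, x) = 1` -/
  vacuum : ∀ (n : ℤ) (v : V), mode Y vac n v = if n = -1 then v else 0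
  /-- `Y(v, x)𝟏` has no singular terms -/
  creation_regular : ∀ (v : V) (n : ℤ), 0 ≤ n → mode Y v n vac = 0
  /-- the constant term of `Y(v, x)𝟏` is `v` -/
  creation : ∀ v : V, mode Y v (-1) vac = v
  jacobi : JacobiIdentity Y Y

/-- An `ℕ`-graded vertex algebra: a vertex algebra `V = ∐_{n ∈ ℤ} V_(n)`, with `V_(n) = 0` for
`n < 0`, such that `[d, Y(u, x)] = x (d/dx) Y(u, x) + Y(du, x)`, where `d` is multiplication by
`n` on `V_(n)`.  For `u ∈ V_(m)`, comparing the coefficients of `x ^ (-n-1)` turns this identity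
into `[d, u_n] = (m - n - 1) u_n`, that is, `u_n V_(k) ⊆ V_(m+k-n-1)` for all `k`. -/
structure NGradedVertexAlgebra (V : Type*) [AddCommGroup V] [Module ℂ V]
    extends VertexAlgebra V where
  /-- `wt n` is the homogeneous subspace `V_(n)` of weight `n` -/
  wt : ℤ → Submodule ℂ V
  isInternal : DirectSum.IsInternal wt
  mode_mem : ∀ (m k n : ℤ) (u v : V), u ∈ wt m → v ∈ wt k → mode Y u n v ∈ wt (m + k - n - 1)
  wt_neg : ∀ n : ℤ, n < 0 → wt n = ⊥

/-- `(W, YW)` is a module for the vertex algebra `V` (no grading is required). -/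
structure IsWeakModule {V : Type*} [AddCommGroup V] [Module ℂ V] (A : VertexAlgebra V)
    {W : Type*} [AddCommGroup W] [Module ℂ W] (YW : V →ₗ[ℂ] VertexOperator ℂ W) : Prop where
  vacuum : ∀ (n : ℤ) (w : W), mode YW A.vac n w = if n = -1 then w else 0
  jacobi : JacobiIdentity A.Y YW

/-- `(W, YW)`, graded by `W = ∐_{n ∈ ℕ} W_(n)`, is an `ℕ`-gradable weak `V`-module: it is a module
for the vertex algebra `V`, and `u_n` maps `W_(k)` to `W_(k+m-n-1)` for `u ∈ V_(m)`, where
`W_(j) = 0` for negative `j`. -/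
structure IsNGradableWeakModule {V : Type*} [AddCommGroup V] [Module ℂ V]
    (A : NGradedVertexAlgebra V) {W : Type*} [AddCommGroup W] [Module ℂ W]
    (YW : V →ₗ[ℂ] VertexOperator ℂ W) (grading : ℕ → Submodule ℂ W) : Prop
    extends IsWeakModule A.toVertexAlgebra YW where
  isInternal : DirectSum.IsInternal grading
  mode_mem : ∀ (m n : ℤ) (k j : ℕ) (u : V) (w : W), u ∈ A.wt m → w ∈ grading k →
    (j : ℤ) = k + m - n - 1 → mode YW u n w ∈ grading j
  mode_eq_zero : ∀ (m n : ℤ) (k : ℕ) (u : V) (w : W), u ∈ A.wt m → w ∈ grading k →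
    (k : ℤ) + m - n - 1 < 0 → mode YW u n w = 0

section Zhu

variable {V : Type*} [AddCommGroup V] [Module ℂ V] (A : NGradedVertexAlgebra V)

theorem wt_bijective : Function.Bijective (DirectSum.coeLinearMap A.wt) :=
  A.isInternal

/-- The linear map out of `V` that is given by `f m` on `V_(m)`. -/
def linearExtend {X : Type*} [AddCommGroup X] [Module ℂ X] (f : (m : ℤ) → A.wt m →ₗ[ℂ] X) :
    V →ₗ[ℂ] X :=
  DirectSum.toModule ℂ ℤ X f ∘ₗ
    (LinearEquiv.ofBijective (DirectSum.coeLinearMap A.wt) (wt_bijective A)).symm.toLinearMap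

theorem linearExtend_apply {X : Type*} [AddCommGroup X] [Module ℂ X]
    (f : (m : ℤ) → A.wt m →ₗ[ℂ] X) (m : ℤ) (u : A.wt m) :
    linearExtend A f (u : V) = f m u := by
  have h : (LinearEquiv.ofBijective (DirectSum.coeLinearMap A.wt) (wt_bijective A)).symm (u : V)
      = DirectSum.lof ℂ ℤ (fun i => A.wt i) m u := by
    rw [LinearEquiv.symm_apply_eq]
    rw [LinearEquiv.ofBijective_apply, DirectSum.coeLinearMap_lof]
  simp only [linearExtend, LinearMap.comp_apply, LinearEquiv.coe_coe, h, DirectSum.toModule_lof]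

/-- The bilinear map `(u, v) ↦ u_n v`. -/
def modeBilin (n : ℤ) : V →ₗ[ℂ] V →ₗ[ℂ] V :=
  (LinearMap.proj n ∘ₗ VertexOperator.ncoeff) ∘ₗ A.Y

/-- The bilinear map `(u, v) ↦ Res_x x^n Y((x+1)^{L(0)} u, x) v`, where `L(0)` is multiplication
by `m` on `V_(m)`; thus it is `∑_j (m choose j) u_{n+j} v` for `u ∈ V_(m)`. -/
def zhuRes (n : ℤ) : V →ₗ[ℂ] V →ₗ[ℂ] V :=
  linearExtend A fun m =>
    (∑ j ∈ Finset.range (m + 1).toNat, Ring.choose m j • modeBilin A (n + j)) ∘ₗ (A.wt m).subtype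

/-- The subspace `O(V)`. -/
def zhuO : Submodule ℂ V :=
  Submodule.span ℂ {x | ∃ (n : ℤ) (u v : V), n ≤ -2 ∧ x = zhuRes A n u v}

/-- The product `u * v` on `V` that induces the multiplication of Zhu's algebra. -/
def zhuMul (u v : V) : V := zhuRes A (-1) u v

/-- Zhu's algebra `A(V) = V / O(V)`. -/
abbrev ZhuAlgebra : Type _ := V ⧸ zhuO A

/-- An `A(V)`-module structure on the vector space `M`, as a representation `ρ` of `A(V)`: a linear
map `ρ : A(V) → End M` that sends the unit, the class of `𝟏`, to the identity, and the product of
two classes, the class of `u * v`, to the composite of their images. -/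
structure ZhuModule (M : Type*) [AddCommGroup M] [Module ℂ M] where
  ρ : ZhuAlgebra A →ₗ[ℂ] Module.End ℂ M
  ρ_one : ρ (Submodule.Quotient.mk A.vac) = 1
  ρ_mul : ∀ u v : V, ρ (Submodule.Quotient.mk (zhuMul A u v)) =
    ρ (Submodule.Quotient.mk u) * ρ (Submodule.Quotient.mk v)

end Zhu

/-! ### The construction of `S(M)` -/

/-- The tensor algebra `T(V[t, t⁻¹])` of the affinization `V[t, t⁻¹] = V ⊗ ℂ[t, t⁻¹]`. -/
abbrev AffTensor (V : Type*) [AddCommGroup V] [Module ℂ V] : Type _ :=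
  TensorAlgebra ℂ (V ⊗[ℂ] LaurentPolynomial ℂ)

/-- The space `T(V[t, t⁻¹]) ⊗ M`, on which `T(V[t, t⁻¹])` acts from the left. -/
abbrev FreeMod (V M : Type*) [AddCommGroup V] [Module ℂ V] [AddCommGroup M] [Module ℂ M] :
    Type _ :=
  AffTensor V ⊗[ℂ] M

section Construction

variable {V : Type*} [AddCommGroup V] [Module ℂ V] {M : Type*} [AddCommGroup M] [Module ℂ M]

/-- The element `u(m) = u ⊗ t^m` of `T(V[t, t⁻¹])`. -/
def gen (u : V) (m : ℤ) : AffTensor V :=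
  TensorAlgebra.ι ℂ (u ⊗ₜ[ℂ] (LaurentPolynomial.T m : LaurentPolynomial ℂ))

/-- `u(m)` as a linear map in `u`. -/
def genLin (m : ℤ) : V →ₗ[ℂ] AffTensor V :=
  TensorAlgebra.ι ℂ ∘ₗ
    (TensorProduct.mk ℂ V (LaurentPolynomial ℂ)).flip (LaurentPolynomial.T m)

/-- The element `w` of `M`, viewed in `T(V[t, t⁻¹]) ⊗ M`. -/
def ofM (V : Type*) [AddCommGroup V] [Module ℂ V] (w : M) : FreeMod V M :=
  (1 : AffTensor V) ⊗ₜ[ℂ] w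

variable (A : NGradedVertexAlgebra V)

/-- `o_t(u)`: it is `u(m - 1)` for `u ∈ V_(m)`, and is linear in `u`. -/
def oT : V →ₗ[ℂ] AffTensor V :=
  linearExtend A fun m => genLin (m - 1) ∘ₗ (A.wt m).subtype

/-- `IsMonomial A d x`: the element `x` is of the form `u₁(m₁) ⋯ u_k(m_k) w` with homogeneous
`u_i ∈ V` and `w ∈ M`, and `d = (wt u₁ - m₁ - 1) + ⋯ + (wt u_k - m_k - 1)`. -/
inductive IsMonomial : ℤ → FreeMod V M → Prop
  | base (w : M) : IsMonomial 0 (ofM V w)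
  | act (k m d : ℤ) (u : V) (x : FreeMod V M) (hu : u ∈ A.wt k) (hx : IsMonomial d x) :
      IsMonomial (k - m - 1 + d) (gen u m • x)

/-- The subspace of `T(V[t, t⁻¹]) ⊗ M` of elements of degree `d`. -/
def degFree (M : Type*) [AddCommGroup M] [Module ℂ M] (d : ℤ) : Submodule ℂ (FreeMod V M) :=
  Submodule.span ℂ {x | IsMonomial A d x}

/-- The element
`u(p)v(q)w - ∑_{i=0}^{k-q-1} ∑_{j=0}^{l} (p-l choose i) (l choose j) (u_{p-l-i+j} v)(q+l+i-j) w`,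
to be used with `k = wt v + deg w` and `l = wt u + deg w`.  The double sum is
`Res_{x₀} Res_{x₂} p(x₀,x₂) x₂^q (x₀+x₂)^l Y_t(Y(u,x₀)v,x₂)w` with
`p(x₀,x₂) = ∑_{i=0}^{k-q-1} (p-l choose i) x₀^{p-l-i} x₂^i`. -/
def productRelation (u v : V) (k l p q : ℤ) (w : FreeMod V M) : FreeMod V M :=
  gen u p • gen v q • w -
    ∑ i ∈ Finset.range (k - q).toNat, ∑ j ∈ Finset.range (l + 1).toNat,
      (Ring.choose (p - l) i * Ring.choose l j) •
        (gen (mode A.Y u (p - l - i + j) v) (q + l + i - j) • w)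

variable (P : ZhuModule A M)

/-- The submodule `𝓘` of `T(V[t, t⁻¹]) ⊗ M`. -/
def relI : Submodule (AffTensor V) (FreeMod V M) :=
  Submodule.span (AffTensor V)
    ({x | ∃ (a d m : ℤ) (u : V) (w : FreeMod V M), u ∈ A.wt a ∧ w ∈ degFree A M d ∧
        a - m - 1 + d < 0 ∧ x = gen u m • w} ∪
     {x | ∃ (u : V) (w : M),
        x = oT A u • ofM V w - ofM V (P.ρ (Submodule.Quotient.mk u) w)} ∪
     {x | ∃ (a b d p q : ℤ) (u v : V) (w : FreeMod V M),
        u ∈ A.wt a ∧ v ∈ A.wt b ∧ w ∈ degFree A M d ∧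
        q < b + d ∧ 0 ≤ (a - p - 1) + (b - q - 1) + d ∧
        x = productRelation A u v (b + d) (a + d) p q w})

/-- `S₁(M) = (T(V[t, t⁻¹]) ⊗ M) / 𝓘`. -/
abbrev S1 : Type _ := FreeMod V M ⧸ relI A P

/-- The subspace of `S₁(M)` of elements of degree `d`. -/
def degS1 (d : ℤ) : Submodule ℂ (S1 A P) :=
  (degFree A M d).map ((relI A P).mkQ.restrictScalars ℂ)

/-- The element `Res_{x₀} Res_{x₂} x₀^{p-l-i} x₂^{q+i} (x₀+x₂)^l Y_{S₁(M)}(Y(u,x₀)v,x₂)w`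
of `S₁(M)`, to be used with `l = wt u + deg w`. -/
def truncationRelation (u v : V) (l p q i : ℤ) (w : S1 A P) : S1 A P :=
  ∑ j ∈ Finset.range (l + 1).toNat,
    Ring.choose l j • (gen (mode A.Y u (p - l - i + j) v) (q + i + l - j) • w)

/-- The submodule `𝓙` of `S₁(M)`. -/
def relJ : Submodule (AffTensor V) (S1 A P) :=
  Submodule.span (AffTensor V)
    {x | ∃ (a b d p q i : ℤ) (u v : V) (w : S1 A P),
        u ∈ A.wt a ∧ v ∈ A.wt b ∧ w ∈ degS1 A P d ∧ b + d - q ≤ i ∧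
        x = truncationRelation A P u v (a + d) p q i w}

/-- `S(M) = S₁(M) / 𝓙`. -/
abbrev S : Type _ := S1 A P ⧸ relJ A P

/-- The subspace `S(M)_(n)` of `S(M)` of elements of degree `n`. -/
def degS (n : ℕ) : Submodule ℂ (S A P) :=
  (degS1 A P n).map ((relJ A P).mkQ.restrictScalars ℂ)

end Construction

end VA

end

/-! The relations impose weak associativity only; the commutator half of the Jacobi identity has to
be deduced.

Let `u`, `v`, `w` be homogeneous and `l = wt u + deg w`. Write `G(x, y)` for the coefficient of
`x₀^(-x-1) x₂^(-y-1)` in `(x₀+x₂)^l Y(Y(u,x₀)v,x₂)w`. The submodule `𝓙` kills `G(x, y)` for `y ≥ wt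
v + deg w`, so the finite sum in the third family of generators of `𝓘` is the full expansion
`u(p+l)v(q)w = ∑_i (p choose i) G(p-i, q+i)` (`gen_smul_gen_smul_eq_binSum`). Inverting this
binomial system (`binSum_inversion`) gives the component `m = l` of the Jacobi identity: its `v u`
term is absent, because `u(m)w = 0` for `m ≥ l`.

Write the failure of the Jacobi identity as a family `f l m n`. Multiplication by `x₀ = x₁ - x₂`
gives `f (l+1) m n = f l (m+1) n - f l m (n+1)`, so the components with larger `m` vanish as well.
Vanishing for large `m` is weak associativity. With `v = 𝟏` it yields the action of the derivatives
of `Y(u,x)` (`mode_creation`); together with skew symmetry in `V` this makes the iterate side, hence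
`f`, antisymmetric under exchanging `(u, m)` with `(v, n)`. So `f` also vanishes for large `n`, and
the recursion spreads the zeros everywhere (`jacobiIdentity_of_eventually`).

This needs `𝟏` to act as the identity. On a vector `u(q)w` that is a Vandermonde convolution
(`vac_smul_gen_smul`); on `M` it reduces to that case since `ρ(𝟏) = 1` gives `w = 𝟏(-1)w`.

The sum of the graded pieces is direct because the operator `2^deg` descends to `S(M)`, where the
pieces lie in different eigenspaces. -/

noncomputable section

namespace VA

/-! ### Sums with generalized binomial coefficients -/

section BinSum

variable {W : Type*} [AddCommGroup W]

/-- The sum `∑_{i ≥ 0} (r choose i) f(i)`, for finitely supported `f`. -/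
def binSum (r : ℤ) (f : ℕ → W) : W := ∑ᶠ i : ℕ, Ring.choose r i • f i

theorem binSum_eq_sum (r : ℤ) {f : ℕ → W} {N : ℕ} (h : ∀ i, N ≤ i → f i = 0) :
    binSum r f = ∑ i ∈ Finset.range N, Ring.choose r i • f i := by
  apply finsum_eq_sum_of_support_subset
  intro i hi
  rw [Function.mem_support] at hi
  by_contra hn
  simp only [Finset.coe_range, Set.mem_Iio, not_lt] at hn
  exact hi (by rw [h i hn, smul_zero])

theorem binSum_eq_single (r : ℤ) {f : ℕ → W} (k : ℕ) (h : ∀ i, i ≠ k → f i = 0) :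
    binSum r f = Ring.choose r k • f k :=
  finsum_eq_single _ k fun i hi => by rw [h i hi, smul_zero]

theorem binSum_eq_zero (r : ℤ) {f : ℕ → W} (h : ∀ i, f i = 0) : binSum r f = 0 := by
  rw [binSum_eq_sum r (N := 0) fun i _ => h i]; simp

theorem binSum_zero_left (f : ℕ → W) : binSum 0 f = f 0 := by
  rw [binSum, finsum_eq_single _ 0]
  · simp
  · intro i hi
    rw [Ring.choose_zero_pos ℤ (Nat.pos_of_ne_zero hi), zero_smul]

theorem binSum_neg (r : ℤ) (f : ℕ → W) : binSum r (fun i => -f i) = -binSum r f := by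
  simp only [binSum, smul_neg, finsum_neg_distrib]

theorem binSum_succ (r : ℤ) {f : ℕ → W} (h : ∃ N, ∀ i, N ≤ i → f i = 0) :
    binSum (r + 1) f = binSum r f + binSum r (fun i => f (i + 1)) := by
  obtain ⟨N, hN⟩ := h
  rw [binSum_eq_sum (N := N + 1) _ fun i hi => hN i (by omega),
    binSum_eq_sum (N := N + 1) _ fun i hi => hN i (by omega),
    binSum_eq_sum (N := N) _ fun i hi => hN (i + 1) (by omega),
    Finset.sum_range_succ', Finset.sum_range_succ' _ N, add_right_comm, ← Finset.sum_add_distrib]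
  simp only [Ring.choose_succ_succ, add_smul, Ring.choose_zero_right]
  congr 1
  exact Finset.sum_congr rfl fun i _ => add_comm _ _

/-- Inversion of the relation `F(p, q) = ∑_i (p choose i) G(p - i, q + i)`. -/
theorem binSum_inversion {F G : ℤ → ℤ → W} {K : ℤ} (hG : ∀ a b, K ≤ b → G a b = 0)
    (hF : ∀ p q, F p q = binSum p fun i => G (p - i) (q + i)) (a b : ℤ) :
    binSum a (fun i => (-1 : ℤ) ^ i • F (a - i) (b + i)) = G a b := by
  have hF' : ∀ (N : ℕ) (p q : ℤ), K ≤ q + N →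
      F p q = ∑ i ∈ Finset.range N, Ring.choose p i • G (p - i) (q + i) := fun N p q h => by
    rw [hF, binSum_eq_sum]
    intro i hi
    exact hG _ _ (by omega)
  -- All terms with `i + j ≥ N` vanish; the extra `1` makes the range nonempty, so that the diagonal
  -- `i + j = 0` can be split off.
  set N := (K - b).toNat + 1 with hN
  rw [binSum_eq_sum (N := N)]
  · have h1 : ∀ i ∈ Finset.range N, Ring.choose a i • (-1 : ℤ) ^ i • F (a - i) (b + i) =
        ∑ j ∈ Finset.range (N - i), (Ring.choose a i * (-1) ^ i * Ring.choose (a - i) j) •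
          G (a - (i + j : ℕ)) (b + (i + j : ℕ)) := by
      intro i hi
      rw [Finset.mem_range] at hi
      rw [hF' (N - i) _ _ (by omega), smul_smul, Finset.smul_sum]
      refine Finset.sum_congr rfl fun j _ => ?_
      rw [smul_smul]
      congr 2 <;> push_cast <;> ring
    rw [Finset.sum_congr rfl h1, ← Finset.sum_range_diag_flip, Finset.sum_range_succ',
      Finset.sum_eq_zero]
    · simp
    · intro n _
      -- On the diagonal `i + j = n + 1`, trinomial revision factors out `a choose (n + 1)`, leaving
      -- the alternating sum of a row of Pascal's triangle, which is zero.
      have h2 : ∀ i ∈ Finset.range (n + 1 + 1),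
          (Ring.choose a i * (-1) ^ i * Ring.choose (a - i) (n + 1 - i)) •
            G (a - (i + (n + 1 - i) : ℕ)) (b + (i + (n + 1 - i) : ℕ)) =
          ((-1) ^ i * ((n + 1).choose i : ℤ)) •
            (Ring.choose a (n + 1) • G (a - (n + 1 : ℕ)) (b + (n + 1 : ℕ))) := by
        intro i hi
        rw [Finset.mem_range] at hi
        have h3 := Ring.choose_smul_choose a (show i ≤ n + 1 by omega)
        rw [Nat.add_sub_cancel' (show i ≤ n + 1 by omega), smul_smul]
        congr 1
        rw [nsmul_eq_mul] at h3
        linear_combination -(-1) ^ i * h3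
      rw [Finset.sum_congr rfl h2, ← Finset.sum_smul, Int.alternating_sum_range_choose]
      simp
  · intro i hi
    rw [hF, binSum_eq_zero, smul_zero]
    intro j
    exact hG _ _ (by omega)

theorem neg_one_pow_mul_choose_neg (j k : ℕ) :
    (-1 : ℤ) ^ k * Ring.choose (-(j : ℤ) - 1) k = (j + k).choose k := by
  rw [show -(j : ℤ) - 1 = -((j : ℤ) + 1) by ring, Ring.choose_neg,
    show (j : ℤ) + 1 + k - 1 = ((j + k : ℕ) : ℤ) by push_cast; ring, Ring.choose_natCast,
    Units.smul_def, Int.coe_negOnePow_natCast, smul_eq_mul, ← mul_assoc, ← mul_pow]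
  simp

end BinSum

/-! ### Propagation of zeros under the Jacobi recursion -/

section BorcherdsRecursion

variable {W : Type*} [AddCommGroup W] {f : ℤ → ℤ → ℤ → W}

/-- Descending induction on `l`: once `f (l + 1)` vanishes, the recursion makes `f l` constant along
each line `m + n = s`, and one zero on the line clears it. -/
theorem eq_zero_of_recursion_left (hf : ∀ l m n, f (l + 1) m n = f l (m + 1) n - f l m (n + 1))
    {N : ℤ} (hN : ∀ l m n, N ≤ l → f l m n = 0) (h0 : ∀ l s, ∃ m, f l m (s - m) = 0)
    (l m n : ℤ) : f l m n = 0 := by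
  suffices h : ∀ (k : ℕ) (l m n : ℤ), N - k ≤ l → f l m n = 0 from
    h (N - l).toNat l m n (by omega)
  intro k
  induction k with
  | zero => exact fun l m n hl => hN l m n (by simpa using hl)
  | succ k ih =>
    intro l m n hl
    have hstep : ∀ m s, f l (m + 1) (s - (m + 1)) = f l m (s - m) := fun m s => by
      have h := hf l m (s - (m + 1))
      rw [ih (l + 1) _ _ (by push_cast at hl; omega),
        show s - (m + 1) + 1 = s - m by ring] at h
      exact sub_eq_zero.1 h.symm
    obtain ⟨m₀, hm₀⟩ := h0 l (m + n)
    have hall : ∀ c, f l c (m + n - c) = 0 := fun c => by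
      induction c using Int.inductionOn' (b := m₀) with
      | zero => exact hm₀
      | succ c _ h => rw [hstep, h]
      | pred c _ h => rw [← hstep, sub_add_cancel, h]
    simpa using hall m

/-- If `m + n ≥ a + b`, then `m ≥ a` or `n ≥ b`. Below that, the recursion at `l - 1` expresses `f l
m n` by two values whose sum of last indices is larger by one. -/
theorem eq_zero_of_recursion_right (hf : ∀ l m n, f (l + 1) m n = f l (m + 1) n - f l m (n + 1))
    {a b : ℤ} (ha : ∀ l m n, a ≤ m → f l m n = 0) (hb : ∀ l m n, b ≤ n → f l m n = 0)
    (l m n : ℤ) : f l m n = 0 := by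
  suffices h : ∀ (k : ℕ) (l m n : ℤ), a + b - k ≤ m + n → f l m n = 0 from
    h (a + b - (m + n)).toNat l m n (by omega)
  intro k
  induction k with
  | zero =>
    intro l m n h
    rcases le_or_gt a m with hm | hm
    · exact ha l m n hm
    · exact hb l m n (by push_cast at h; omega)
  | succ k ih =>
    intro l m n h
    have := hf (l - 1) m n
    rwa [ih _ (m + 1) n (by push_cast at h; omega), ih _ m (n + 1) (by push_cast at h; omega),
      sub_add_cancel, sub_zero] at this

end BorcherdsRecursion

/-! ### The defect of the Jacobi identity and its recursion -/

section Defect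

variable {V : Type*} [AddCommGroup V] [Module ℂ V]
variable {W : Type*} [AddCommGroup W] [Module ℂ W]

theorem mode_eq_zero_of_large (YW : V →ₗ[ℂ] VertexOperator ℂ W) (u : V) (w : W) :
    ∃ N : ℤ, ∀ n, N ≤ n → mode YW u n w = 0 :=
  ⟨-((HahnModule.of ℂ).symm (YW u w)).order, fun n hn =>
    VertexOperator.ncoeff_eq_zero_of_lt_order _ _ _ (by omega)⟩

/-- The linear map `u ↦ u_n w`. -/
def modeAt (YW : V →ₗ[ℂ] VertexOperator ℂ W) (n : ℤ) (w : W) : V →ₗ[ℂ] W :=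
  LinearMap.applyₗ w ∘ₗ LinearMap.proj n ∘ₗ VertexOperator.ncoeff ∘ₗ YW

theorem modeAt_apply (YW : V →ₗ[ℂ] VertexOperator ℂ W) (n : ℤ) (w : W) (u : V) :
    modeAt YW n w u = mode YW u n w := rfl

/-- The sum `∑_i (-1)^i (l choose i) u_{m+l-i} v_{n+i} w`. -/
def productSum (YW : V →ₗ[ℂ] VertexOperator ℂ W) (u v : V) (w : W) (l m n : ℤ) : W :=
  binSum l fun i => (-1 : ℤ) ^ i • mode YW u (m + l - i) (mode YW v (n + i) w)

/-- The sum `∑_i (m choose i) (u_{l+i} v)_{m+n-i} w`. -/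
def iterateSum (Y : V →ₗ[ℂ] VertexOperator ℂ V) (YW : V →ₗ[ℂ] VertexOperator ℂ W)
    (u v : V) (w : W) (l m n : ℤ) : W :=
  binSum m fun i => mode YW (mode Y u (l + i) v) (m + n - i) w

/-- The difference of the two sides of the Jacobi identity. -/
def jacobiDefect (Y : V →ₗ[ℂ] VertexOperator ℂ V) (YW : V →ₗ[ℂ] VertexOperator ℂ W)
    (u v : V) (w : W) (l m n : ℤ) : W :=
  productSum YW u v w l m n - (Int.negOnePow l : ℤ) • productSum YW v u w l n m
    - iterateSum Y YW u v w l m n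

variable (Y : V →ₗ[ℂ] VertexOperator ℂ V) (YW : V →ₗ[ℂ] VertexOperator ℂ W)

theorem jacobiIdentity_iff :
    JacobiIdentity Y YW ↔ ∀ u v w l m n, jacobiDefect Y YW u v w l m n = 0 := by
  have h : ∀ u v w l m n, jacobiDefect Y YW u v w l m n =
      (∑ᶠ i : ℕ, ((-1) ^ i * Ring.choose l i) •
        mode YW u (m + l - i) (mode YW v (n + i) w))
      - (∑ᶠ i : ℕ, ((Int.negOnePow l : ℤ) * (-1) ^ i * Ring.choose l i) •
        mode YW v (n + l - i) (mode YW u (m + i) w))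
      - ∑ᶠ i : ℕ, Ring.choose m i • mode YW (mode Y u (l + i) v) (m + n - i) w := by
    intro u v w l m n
    simp only [jacobiDefect, productSum, iterateSum, binSum]
    congr 2
    · refine finsum_congr fun i => ?_
      rw [smul_smul, mul_comm]
    · rcases Int.units_eq_one_or l.negOnePow with h | h <;>
        simp only [h, Units.val_neg, Units.val_one, one_smul, neg_smul, ← finsum_neg_distrib] <;>
        refine finsum_congr fun i => ?_ <;>
        simp only [smul_smul, ← neg_smul] <;>
        congr 1 <;>
        ring
  simp only [JacobiIdentity, h, sub_eq_zero (a := _ - _)]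

theorem productSum_recursion (u v : V) (w : W) (l m n : ℤ) :
    productSum YW u v w (l + 1) m n =
      productSum YW u v w l (m + 1) n - productSum YW u v w l m (n + 1) := by
  obtain ⟨N, hN⟩ := mode_eq_zero_of_large YW v w
  rw [productSum, binSum_succ _ ⟨(N - n).toNat, fun i hi => by
    rw [hN _ (by omega), map_zero, smul_zero]⟩, sub_eq_add_neg, productSum, productSum, ← binSum_neg]
  congr 2 <;> funext i
  · rw [show m + (l + 1) - i = m + 1 + l - i by ring]
  · rw [show m + (l + 1) - (i + 1 : ℕ) = m + l - i by push_cast; ring,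
      show n + (i + 1 : ℕ) = n + 1 + i by push_cast; ring, pow_succ, mul_neg_one, neg_smul]

theorem iterateSum_recursion (u v : V) (w : W) (l m n : ℤ) :
    iterateSum Y YW u v w (l + 1) m n =
      iterateSum Y YW u v w l (m + 1) n - iterateSum Y YW u v w l m (n + 1) := by
  obtain ⟨N, hN⟩ := mode_eq_zero_of_large Y u v
  rw [eq_sub_iff_add_eq, eq_comm, add_comm _ (iterateSum _ _ _ _ _ l m (n + 1)), iterateSum,
    binSum_succ _ ⟨(N - l).toNat, fun i hi => by
    rw [hN _ (by omega), ← modeAt_apply, map_zero]⟩]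
  simp only [iterateSum]
  congr 2 <;> funext i
  · congr 2; ring
  · rw [show m + 1 + n - (i + 1 : ℕ) = m + n - i by push_cast; ring,
      show l + (i + 1 : ℕ) = l + 1 + i by push_cast; ring]

/-- Coefficient form of multiplication by `x₀ = x₁ - x₂`. Each of the three terms satisfies it
separately, by Pascal's rule. -/
theorem jacobiDefect_recursion (u v : V) (w : W) (l m n : ℤ) :
    jacobiDefect Y YW u v w (l + 1) m n =
      jacobiDefect Y YW u v w l (m + 1) n - jacobiDefect Y YW u v w l m (n + 1) := by
  simp only [jacobiDefect, productSum_recursion, iterateSum_recursion, Int.negOnePow_succ,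
    Units.val_neg, neg_smul, smul_sub]
  abel

theorem iterateSum_eq_zero_of_large (u v : V) (w : W) :
    ∃ N : ℤ, ∀ l m n, N ≤ l → iterateSum Y YW u v w l m n = 0 := by
  obtain ⟨N, hN⟩ := mode_eq_zero_of_large Y u v
  exact ⟨N, fun l m n hl => binSum_eq_zero _ fun i => by
    rw [hN _ (by omega), ← modeAt_apply, map_zero]⟩

theorem negOnePow_mul_self (l : ℤ) : (l.negOnePow : ℤ) * l.negOnePow = 1 := by
  rw [← Units.val_mul, Int.units_mul_self, Units.val_one]

end Defect

/-! ### From weak associativity to the Jacobi identity -/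

section Jacobi

variable {V : Type*} [AddCommGroup V] [Module ℂ V] (A : VertexAlgebra V)
variable {W : Type*} [AddCommGroup W] [Module ℂ W] {YW : V →ₗ[ℂ] VertexOperator ℂ W}

/-- For `l ≥ 0` the iterate side vanishes by creation, and the identity operator commutes with every
mode. Negative `l` follows from `eq_zero_of_recursion_left`, the zero on each line being supplied by
weak associativity at `m = k`. -/
theorem jacobiDefect_vac (hvac : ∀ (n : ℤ) (w : W), mode YW A.vac n w = if n = -1 then w else 0)
    {u : V} {w : W} {k : ℤ} (h : ∀ l m n, k ≤ m → jacobiDefect A.Y YW u A.vac w l m n = 0)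
    (l m n : ℤ) : jacobiDefect A.Y YW u A.vac w l m n = 0 := by
  refine eq_zero_of_recursion_left (jacobiDefect_recursion A.Y YW u A.vac w) (N := 0) ?_
    (fun l s => ⟨k, h l k _ le_rfl⟩) l m n
  have h0 : ∀ m n, jacobiDefect A.Y YW u A.vac w 0 m n = 0 := by
    intro m n
    have hR : iterateSum A.Y YW u A.vac w 0 m n = 0 := binSum_eq_zero _ fun i => by
      rw [A.creation_regular _ _ (by omega), ← modeAt_apply, map_zero]
    rw [jacobiDefect, hR, productSum, productSum, binSum_zero_left, binSum_zero_left]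
    simp only [hvac]
    by_cases hn : n = -1 <;> simp [hn]
  intro l m n hl
  obtain ⟨l, rfl⟩ := Int.eq_ofNat_of_zero_le hl
  clear hl
  induction l generalizing m n with
  | zero => exact h0 m n
  | succ l ih => rw [Nat.cast_succ, jacobiDefect_recursion, ih, ih, sub_zero]

/-- The action of the divided powers of the translation operator. -/
theorem mode_creation (hvac : ∀ (n : ℤ) (w : W), mode YW A.vac n w = if n = -1 then w else 0)
    {u : V} {w : W} {k : ℤ} (h : ∀ l m n, k ≤ m → jacobiDefect A.Y YW u A.vac w l m n = 0)
    (j : ℕ) (n : ℤ) : mode YW (mode A.Y u (-(j : ℤ) - 1) A.vac) n w =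
      ((-1) ^ j * Ring.choose n j) • mode YW u (n - j) w := by
  have hD := jacobiDefect_vac A hvac h (-(j : ℤ) - 1) 0 n
  have hR : iterateSum A.Y YW u A.vac w (-(j : ℤ) - 1) 0 n =
      mode YW (mode A.Y u (-(j : ℤ) - 1) A.vac) n w := by
    rw [iterateSum, binSum_zero_left]; simp
  rw [jacobiDefect, hR, sub_eq_zero] at hD
  rw [← hD]
  simp only [productSum, hvac]
  have hsign : ((-(j : ℤ) - 1).negOnePow : ℤ) = -(-1) ^ j := by
    rw [show -(j : ℤ) - 1 = -((j + 1 : ℕ) : ℤ) by push_cast; ring, Int.negOnePow_neg,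
      Int.coe_negOnePow_natCast, pow_succ]
    ring
  rw [hsign]
  -- The vacuum mode must have index `-1`, so only the first product sum can contribute if `n < 0`
  -- and only the second if `n ≥ 0`, each with at most one term.
  rcases lt_or_ge n 0 with hn | hn
  · obtain ⟨k, rfl⟩ : ∃ k : ℕ, n = -(k : ℤ) - 1 := ⟨(-1 - n).toNat, by omega⟩
    rw [binSum_eq_single _ k, binSum_eq_zero _ fun i => by rw [if_neg (by omega), smul_zero],
      smul_zero, sub_zero, if_pos (by ring), smul_smul, mul_comm, neg_one_pow_mul_choose_neg,
      neg_one_pow_mul_choose_neg]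
    · rw [add_comm k j, Nat.choose_symm_add]
      congr 3
      ring
    · intro i hi
      rw [if_neg (by omega), map_zero, smul_zero]
  · obtain ⟨n, rfl⟩ := Int.eq_ofNat_of_zero_le hn
    rw [binSum_eq_zero _ fun i => by rw [if_neg (by omega), map_zero, smul_zero], zero_sub,
      neg_smul, neg_neg, Ring.choose_natCast, mul_smul]
    congr 1
    rcases lt_or_ge n j with hj | hj
    · rw [Nat.choose_eq_zero_of_lt hj, Nat.cast_zero, zero_smul]
      exact binSum_eq_zero _ fun i => by rw [if_neg (by omega), smul_zero]
    · obtain ⟨i, rfl⟩ := Nat.exists_eq_add_of_le hj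
      rw [binSum_eq_single _ i, if_pos (by push_cast; ring), smul_smul, mul_comm,
        neg_one_pow_mul_choose_neg, Nat.choose_symm_add]
      · congr 3
        push_cast; ring
      · intro i' hi'
        rw [if_neg (by omega), smul_zero]

/-- Coefficient form of `Y(u,x)v = e^{xD} Y(v,-x)u`, read off from the Jacobi identity for `v`, `u`,
`𝟏` at `m = -1`, `n = 0`, where creation leaves only one term on the product side. -/
theorem VertexAlgebra.skew_symmetry (u v : V) (l : ℤ) :
    mode A.Y u l v = -(l.negOnePow : ℤ) •
      binSum (-1) fun i => mode A.Y (mode A.Y v (l + i) u) (-(i : ℤ) - 1) A.vac := by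
  have h := (jacobiIdentity_iff A.Y A.Y).1 A.jacobi v u A.vac l (-1) 0
  have h1 : productSum A.Y v u A.vac l (-1) 0 = 0 := binSum_eq_zero _ fun i => by
    rw [A.creation_regular _ _ (by omega), map_zero, smul_zero]
  have h2 : productSum A.Y u v A.vac l 0 (-1) = mode A.Y u l v := by
    rw [productSum, binSum_eq_single _ 0]
    · simp [A.creation]
    · intro i hi
      rw [A.creation_regular _ _ (by omega), map_zero, smul_zero]
  rw [jacobiDefect, h1, h2, zero_sub, sub_eq_zero, iterateSum] at h
  have h3 := congrArg ((l.negOnePow : ℤ) • ·) h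
  simp only [smul_neg, smul_smul, negOnePow_mul_self, one_smul] at h3
  rw [neg_eq_iff_eq_neg] at h3
  rw [h3, neg_smul]
  congr 3
  funext i
  congr 2
  ring

/-- Both iterate sums vanish for large `l` and obey the recursion, so one point on each line `m + n
= s` suffices. At `m = 0` the claim is skew symmetry followed by `mode_creation`. -/
theorem iterateSum_swap (hvac : ∀ (n : ℤ) (w : W), mode YW A.vac n w = if n = -1 then w else 0)
    (h : ∀ (u v : V) (w : W), ∃ k, ∀ l m n, k ≤ m → jacobiDefect A.Y YW u v w l m n = 0)
    (u v : V) (w : W) (l m n : ℤ) :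
    iterateSum A.Y YW u v w l m n + (l.negOnePow : ℤ) • iterateSum A.Y YW v u w l n m = 0 := by
  obtain ⟨N₁, hN₁⟩ := iterateSum_eq_zero_of_large A.Y YW u v w
  obtain ⟨N₂, hN₂⟩ := iterateSum_eq_zero_of_large A.Y YW v u w
  refine eq_zero_of_recursion_left (f := fun l m n => iterateSum A.Y YW u v w l m n +
    (l.negOnePow : ℤ) • iterateSum A.Y YW v u w l n m) (N := max N₁ N₂) ?_ ?_ ?_ l m n
  · intro l m n
    simp only [iterateSum_recursion, Int.negOnePow_succ, Units.val_neg, neg_smul, smul_sub]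
    abel
  · intro l m n hl
    simp only [hN₁ _ _ _ (le_trans (le_max_left _ _) hl), hN₂ _ _ _ (le_trans (le_max_right _ _) hl),
      smul_zero, add_zero]
  · intro l n
    refine ⟨0, ?_⟩
    obtain ⟨N, hN⟩ := mode_eq_zero_of_large A.Y v u
    have hz : ∀ i : ℕ, (N - l).toNat ≤ i → mode A.Y v (l + i) u = 0 := fun i hi =>
      hN _ (by omega)
    have h1 : iterateSum A.Y YW u v w l 0 (n - 0) = mode YW (mode A.Y u l v) n w := by
      rw [iterateSum, binSum_zero_left]; simp
    have h2 : mode YW (mode A.Y u l v) n w =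
        -(l.negOnePow : ℤ) • iterateSum A.Y YW v u w l (n - 0) 0 := by
      rw [A.skew_symmetry u v l, iterateSum, binSum_eq_sum (N := (N - l).toNat),
        binSum_eq_sum (N := (N - l).toNat), ← modeAt_apply, map_zsmul, map_sum]
      · congr 1
        refine Finset.sum_congr rfl fun i _ => ?_
        obtain ⟨k, hk⟩ := h (mode A.Y v (l + i) u) A.vac w
        rw [map_zsmul, modeAt_apply, mode_creation A hvac hk, smul_smul, ← mul_assoc,
          mul_comm (Ring.choose _ _)]
        have := neg_one_pow_mul_choose_neg 0 i
        simp only [Nat.cast_zero, neg_zero, zero_sub, zero_add, Nat.choose_self, Nat.cast_one]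
          at this
        rw [this, one_mul, sub_zero, add_zero]
      · intro i hi
        rw [hz i hi, ← modeAt_apply, map_zero]
      · intro i hi
        rw [hz i hi, ← modeAt_apply, map_zero]
    simp only [h1, h2, neg_smul, neg_add_cancel]

/-- If the vacuum acts as the identity, then the Jacobi identity follows from its components with
large `m`. -/
theorem jacobiIdentity_of_eventually
    (hvac : ∀ (n : ℤ) (w : W), mode YW A.vac n w = if n = -1 then w else 0)
    (h : ∀ (u v : V) (w : W), ∃ k, ∀ l m n, k ≤ m → jacobiDefect A.Y YW u v w l m n = 0) :
    JacobiIdentity A.Y YW := by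
  rw [jacobiIdentity_iff]
  intro u v w
  -- The product terms are antisymmetric by their form and the iterate terms by `iterateSum_swap`;
  -- vanishing for large `m` thus becomes vanishing for large `n`.
  have hswap : ∀ l m n, jacobiDefect A.Y YW u v w l m n =
      -(l.negOnePow : ℤ) • jacobiDefect A.Y YW v u w l n m := fun l m n => by
    have h' := eq_neg_of_add_eq_zero_left (iterateSum_swap A hvac h u v w l m n)
    rw [jacobiDefect, jacobiDefect, h']
    simp only [smul_sub, smul_smul, neg_mul, negOnePow_mul_self]
    module
  obtain ⟨a, ha⟩ := h u v w
  obtain ⟨b, hb⟩ := h v u w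
  exact eq_zero_of_recursion_right (jacobiDefect_recursion A.Y YW u v w) ha
    fun l m n hn => by rw [hswap, hb _ _ _ hn, smul_zero]

end Jacobi

/-! ### Vertex operators from their modes -/

section OfModes

variable {V : Type*} [AddCommGroup V] [Module ℂ V]
variable {W : Type*} [AddCommGroup W] [Module ℂ W]

theorem bddBelow_support_modes {f : ℤ → V →ₗ[ℂ] Module.End ℂ W}
    (hf : ∀ u w, ∃ N, ∀ m, N ≤ m → f m u w = 0) (u : V) (w : W) :
    BddBelow (Function.support fun n => f (-n - 1) u w) := by
  obtain ⟨N, hN⟩ := hf u w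
  refine ⟨-N, fun n hn => ?_⟩
  by_contra h
  exact hn (hN _ (by omega))

/-- The vertex operator map with the given lower truncated modes. -/
def ofModes (f : ℤ → V →ₗ[ℂ] Module.End ℂ W) (hf : ∀ u w, ∃ N, ∀ m, N ≤ m → f m u w = 0) :
    V →ₗ[ℂ] VertexOperator ℂ W where
  toFun u := VertexOperator.of_coeff (fun n => f (-n - 1) u) (bddBelow_support_modes hf u)
  map_add' u v := by
    apply HVertexOperator.coeff_inj
    funext n
    simp only [map_add, Pi.add_apply, VertexOperator.of_coeff, HVertexOperator.coeff_of_coeff]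
  map_smul' c u := by
    apply HVertexOperator.coeff_inj
    funext n
    simp only [map_smul, Pi.smul_apply, VertexOperator.of_coeff, HVertexOperator.coeff_of_coeff,
      RingHom.id_apply]

theorem mode_ofModes (f : ℤ → V →ₗ[ℂ] Module.End ℂ W)
    (hf : ∀ u w, ∃ N, ∀ m, N ≤ m → f m u w = 0) (u : V) (m : ℤ) :
    mode (ofModes f hf) u m = f m u := by
  refine (VertexOperator.ncoeff_of_coeff (fun n => f (-n - 1) u) (bddBelow_support_modes hf u) m).trans ?_
  rw [show -(-m - 1) - 1 = m by ring]

end OfModes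

/-! ### Homogeneous elements of the free module, and the weight of the vacuum -/

section FreeModule

variable {V : Type*} [AddCommGroup V] [Module ℂ V] {M : Type*} [AddCommGroup M] [Module ℂ M]
variable (A : NGradedVertexAlgebra V)

theorem genLin_apply (m : ℤ) (u : V) : genLin m u = gen u m := rfl

theorem gen_zero (m : ℤ) : gen (0 : V) m = 0 := by rw [← genLin_apply, map_zero]

theorem gen_add (u v : V) (m : ℤ) : gen (u + v) m = gen u m + gen v m := by
  simp only [← genLin_apply, map_add]

@[elab_as_elim]
theorem homogeneous_induction {p : V → Prop} (u : V) (hom : ∀ a, ∀ u ∈ A.wt a, p u) (zero : p 0)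
    (add : ∀ u v, p u → p v → p (u + v)) : p u :=
  Submodule.iSup_induction A.wt (motive := p)
    (by rw [A.isInternal.submodule_iSup_eq_top]; trivial) hom zero add

theorem oT_apply {a : ℤ} {u : V} (hu : u ∈ A.wt a) : oT A u = gen u (a - 1) :=
  linearExtend_apply A (fun m => genLin (m - 1) ∘ₗ (A.wt m).subtype) a ⟨u, hu⟩

theorem gen_smul_mem_degFree {a d m : ℤ} {u : V} {w : FreeMod V M} (hu : u ∈ A.wt a)
    (hw : w ∈ degFree A M d) : gen u m • w ∈ degFree A M (a - m - 1 + d) := by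
  induction hw using Submodule.span_induction with
  | mem x hx => exact Submodule.subset_span (.act a m d u x hu hx)
  | zero => rw [smul_zero]; exact zero_mem _
  | add x y _ _ hx hy => rw [smul_add]; exact add_mem hx hy
  | smul c x _ hx => rw [smul_comm]; exact Submodule.smul_mem _ c hx

/-- The span contains `M` and is stable under each `u(m)`, since `V` is spanned by homogeneous
vectors; these `u(m)` generate the tensor algebra. -/
theorem span_isMonomial : Submodule.span ℂ {x : FreeMod V M | ∃ d, IsMonomial A d x} = ⊤ := by
  set N := Submodule.span ℂ {x : FreeMod V M | ∃ d, IsMonomial A d x}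
  have hgen : ∀ (u : V) (m : ℤ), ∀ x ∈ N, gen u m • x ∈ N := by
    intro u m x hx
    induction hx using Submodule.span_induction with
    | mem x hx =>
      obtain ⟨d, hx⟩ := hx
      induction u using homogeneous_induction A with
      | hom a u hu => exact Submodule.subset_span ⟨_, .act a m d u x hu hx⟩
      | zero => rw [gen_zero, zero_smul]; exact zero_mem _
      | add u v hu hv => rw [gen_add, add_smul]; exact add_mem hu hv
    | zero => rw [smul_zero]; exact zero_mem _
    | add x y _ _ hx hy => rw [smul_add]; exact add_mem hx hy
    | smul c x _ hx => rw [smul_comm]; exact Submodule.smul_mem _ c hx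
  have hι : ∀ (y : V ⊗[ℂ] LaurentPolynomial ℂ), ∀ x ∈ N, TensorAlgebra.ι ℂ y • x ∈ N := by
    intro y x hx
    induction y using TensorProduct.induction_on with
    | zero => rw [map_zero, zero_smul]; exact zero_mem _
    | add y z hy hz => rw [map_add, add_smul]; exact add_mem hy hz
    | tmul u f =>
      induction f using LaurentPolynomial.induction_on' with
      | add f g hf hg =>
        rw [TensorProduct.tmul_add, map_add, add_smul]; exact add_mem hf hg
      | C_mul_T n c =>
        rw [← LaurentPolynomial.smul_eq_C_mul, TensorProduct.tmul_smul, map_smul, smul_assoc]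
        exact Submodule.smul_mem _ _ (hgen u n x hx)
  have hT : ∀ (t : AffTensor V), ∀ x ∈ N, t • x ∈ N := by
    intro t
    induction t using TensorAlgebra.induction with
    | algebraMap c => intro x hx; rw [algebraMap_smul]; exact Submodule.smul_mem _ _ hx
    | ι y => exact hι y
    | mul s t hs ht => intro x hx; rw [mul_smul]; exact hs _ (ht _ hx)
    | add s t hs ht => intro x hx; rw [add_smul]; exact add_mem (hs _ hx) (ht _ hx)
  rw [eq_top_iff]
  rintro x -
  induction x using TensorProduct.induction_on with
  | zero => exact zero_mem _
  | add x y hx hy => exact add_mem hx hy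
  | tmul t w =>
    rw [show t ⊗ₜ[ℂ] w = t • ofM V w by rw [ofM, TensorProduct.smul_tmul', smul_eq_mul, mul_one]]
    exact hT t _ (Submodule.subset_span ⟨0, .base w⟩)

theorem isMonomial_mem_degFree {d : ℤ} {x : FreeMod V M} (hx : IsMonomial A d x) :
    x ∈ degFree A M d := Submodule.subset_span hx

/-- Since `v_{-1}𝟏 = v`, the component of weight `0` of `𝟏` is a right unit for `u_{-1}v`, hence it
equals `𝟏`. -/
theorem vac_mem_wt_zero : A.vac ∈ A.wt 0 := by
  classical
  let π : ℤ → V →ₗ[ℂ] V := fun k =>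
    linearExtend A fun m => if m = k then (A.wt m).subtype else 0
  have hπ : ∀ k a, ∀ x ∈ A.wt a, π k x = if a = k then x else 0 := fun k a x hx => by
    rw [show π k x = _ from linearExtend_apply A _ a ⟨x, hx⟩]
    split_ifs <;> rfl
  have hmem : ∀ x, π 0 x ∈ A.wt 0 := fun x => by
    induction x using homogeneous_induction A with
    | hom a u hu =>
      rw [hπ 0 a u hu]
      split_ifs with h
      · exact h ▸ hu
      · exact zero_mem _
    | zero => rw [map_zero]; exact zero_mem _
    | add u v hu hv => rw [map_add]; exact add_mem hu hv
  -- Here `π k` is the projection onto weight `k`, and `v_{-1}` raises weights by exactly `k`.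
  have hcomm : ∀ k, ∀ v ∈ A.wt k, ∀ x, mode A.Y v (-1) (π 0 x) = π k (mode A.Y v (-1) x) := by
    intro k v hv x
    induction x using homogeneous_induction A with
    | hom a x hx =>
      rw [hπ 0 a x hx, hπ k (k + a - (-1) - 1) _ (A.mode_mem k a (-1) v x hv hx)]
      by_cases h : a = 0
      · rw [if_pos h, if_pos (by omega)]
      · rw [if_neg h, if_neg (by omega), map_zero]
    | zero => simp only [map_zero]
    | add x y hx hy => simp only [map_add, hx, hy]
  have hright : ∀ v, mode A.Y v (-1) (π 0 A.vac) = v := by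
    intro v
    induction v using homogeneous_induction A with
    | hom k v hv => rw [hcomm k v hv, A.creation, hπ k k v hv, if_pos rfl]
    | zero => rw [← modeAt_apply, map_zero]
    | add x y hx hy => rw [← modeAt_apply, map_add, modeAt_apply, modeAt_apply, hx, hy]
  have h := hright A.vac
  rw [A.vacuum, if_pos rfl] at h
  rw [← h]
  exact hmem _

end FreeModule

/-! ### The defining relations in `S(M)` and the operator `Y_{S(M)}` -/

section Quotient

variable {V : Type*} [AddCommGroup V] [Module ℂ V] {M : Type*} [AddCommGroup M] [Module ℂ M]
variable (A : NGradedVertexAlgebra V) (P : ZhuModule A M)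

/-- The quotient map `T(V[t, t⁻¹]) ⊗ M → S(M)`. -/
def mkS : FreeMod V M →ₗ[AffTensor V] S A P := (relJ A P).mkQ ∘ₗ (relI A P).mkQ

theorem mkS_surjective : Function.Surjective (mkS A P) :=
  (Submodule.mkQ_surjective _).comp (Submodule.mkQ_surjective _)

/-- The elements of `S(M)` of degree `d ∈ ℤ`. -/
def degSInt (d : ℤ) : Submodule ℂ (S A P) := (degFree A M d).map ((mkS A P).restrictScalars ℂ)

theorem degS_eq (n : ℕ) : degS A P n = degSInt A P n := by
  rw [degS, degS1, degSInt, ← Submodule.map_comp]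
  rfl

variable {A P}

theorem mkS_eq_zero {x : FreeMod V M} (hx : x ∈ relI A P) : mkS A P x = 0 := by
  rw [mkS, LinearMap.comp_apply, Submodule.mkQ_apply (relI A P),
    (Submodule.Quotient.mk_eq_zero _).2 hx, map_zero]

theorem gen_smul_eq_zero {a d m : ℤ} {u : V} {w : S A P} (hu : u ∈ A.wt a)
    (hw : w ∈ degSInt A P d) (h : a - m - 1 + d < 0) : gen u m • w = 0 := by
  obtain ⟨x, hx, rfl⟩ := hw
  rw [LinearMap.restrictScalars_apply, ← map_smul]
  exact mkS_eq_zero (Submodule.subset_span (Or.inl (Or.inl ⟨a, d, m, u, x, hu, hx, h, rfl⟩)))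

theorem gen_smul_mem_degSInt {a d m : ℤ} {u : V} {w : S A P} (hu : u ∈ A.wt a)
    (hw : w ∈ degSInt A P d) : gen u m • w ∈ degSInt A P (a - m - 1 + d) := by
  obtain ⟨x, hx, rfl⟩ := hw
  rw [LinearMap.restrictScalars_apply, ← map_smul]
  exact ⟨_, gen_smul_mem_degFree A hu hx, rfl⟩

theorem oT_smul (u : V) (w : M) :
    oT A u • mkS A P (ofM V w) = mkS A P (ofM V (P.ρ (Submodule.Quotient.mk u) w)) := by
  rw [← sub_eq_zero, ← map_smul, ← map_sub]
  exact mkS_eq_zero (Submodule.subset_span (Or.inl (Or.inr ⟨u, w, rfl⟩)))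

theorem gen_smul_gen_smul {a b d p q : ℤ} {u v : V} {w : S A P} (hu : u ∈ A.wt a)
    (hv : v ∈ A.wt b) (hw : w ∈ degSInt A P d) (hq : q < b + d)
    (h : 0 ≤ (a - p - 1) + (b - q - 1) + d) :
    gen u p • gen v q • w =
      ∑ i ∈ Finset.range (b + d - q).toNat, ∑ j ∈ Finset.range (a + d + 1).toNat,
        (Ring.choose (p - (a + d)) i * Ring.choose (a + d) j) •
          (gen (mode A.Y u (p - (a + d) - i + j) v) (q + (a + d) + i - j) • w) := by
  obtain ⟨x, hx, rfl⟩ := hw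
  have := mkS_eq_zero (A := A) (P := P)
    (Submodule.subset_span (Or.inr ⟨a, b, d, p, q, u, v, x, hu, hv, hx, hq, h, rfl⟩))
  rw [productRelation, map_sub, sub_eq_zero] at this
  simpa only [LinearMap.restrictScalars_apply, map_smul, map_sum, map_zsmul] using this

theorem sum_gen_smul_eq_zero {a b d x y : ℤ} {u v : V} {w : S A P} (hu : u ∈ A.wt a)
    (hv : v ∈ A.wt b) (hw : w ∈ degSInt A P d) (hy : b + d ≤ y) :
    ∑ j ∈ Finset.range (a + d + 1).toNat, Ring.choose (a + d) j •
      (gen (mode A.Y u (x + j) v) (y + (a + d) - j) • w) = 0 := by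
  obtain ⟨w, hw, rfl⟩ := hw
  -- The index `i` of the generators can be absorbed into `p` and `q`, so `i = 0` is enough.
  have h : truncationRelation A P u v (a + d) (x + (a + d)) y 0 ((relI A P).mkQ w) ∈ relJ A P :=
    Submodule.subset_span ⟨a, b, d, _, y, 0, u, v, _, hu, hv, ⟨w, hw, rfl⟩, by omega, rfl⟩
  replace h : (relJ A P).mkQ _ = 0 := (Submodule.Quotient.mk_eq_zero _).2 h
  simpa only [truncationRelation, map_sum, map_zsmul, map_smul, LinearMap.restrictScalars_apply,
    mkS, LinearMap.comp_apply, add_zero, sub_zero, Int.cast_zero, add_sub_cancel_right] using h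

theorem mkS_isMonomial_of_neg {d : ℤ} {x : FreeMod V M} (hx : IsMonomial A d x) (hd : d < 0) :
    mkS A P x = 0 := by
  cases hx with
  | base w => exact absurd hd (lt_irrefl _)
  | act k m d u x hu hx =>
    rw [map_smul]
    exact gen_smul_eq_zero hu ⟨x, isMonomial_mem_degFree A hx, rfl⟩ hd

theorem degSInt_of_neg {d : ℤ} (hd : d < 0) : degSInt A P d = ⊥ := by
  rw [degSInt, degFree, Submodule.map_span, Submodule.span_eq_bot]
  rintro _ ⟨x, hx, rfl⟩
  exact mkS_isMonomial_of_neg hx hd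

theorem mkS_mem_degSInt {d : ℤ} {x : FreeMod V M} (hx : IsMonomial A d x) :
    mkS A P x ∈ degSInt A P d := ⟨x, isMonomial_mem_degFree A hx, rfl⟩

@[elab_as_elim]
theorem monomial_induction {p : S A P → Prop} (w : S A P)
    (mono : ∀ d x, IsMonomial A d x → p (mkS A P x)) (zero : p 0)
    (add : ∀ w w', p w → p w' → p (w + w')) (smul : ∀ (c : ℂ) w, p w → p (c • w)) : p w := by
  obtain ⟨x, rfl⟩ := mkS_surjective A P w
  have hx : x ∈ Submodule.span ℂ {x : FreeMod V M | ∃ d, IsMonomial A d x} := by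
    rw [span_isMonomial]; trivial
  induction hx using Submodule.span_induction with
  | mem x hx => obtain ⟨d, hx⟩ := hx; exact mono d x hx
  | zero => rwa [map_zero]
  | add x y _ _ hx hy => rw [map_add]; exact add _ _ hx hy
  | smul c x _ hx =>
    rw [← LinearMap.restrictScalars_apply ℂ, map_smul]; exact smul _ _ hx

theorem gen_smul_eq_zero_of_large (u : V) (w : S A P) : ∃ N, ∀ m, N ≤ m → gen u m • w = 0 := by
  induction u using homogeneous_induction A with
  | hom a u hu =>
    induction w using monomial_induction with
    | mono d x hx =>
      exact ⟨a + d, fun m hm => gen_smul_eq_zero hu (mkS_mem_degSInt hx) (by omega)⟩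
    | zero => exact ⟨0, fun m _ => smul_zero _⟩
    | add w w' h h' =>
      obtain ⟨N, hN⟩ := h
      obtain ⟨N', hN'⟩ := h'
      exact ⟨max N N', fun m hm => by rw [smul_add, hN m (by omega), hN' m (by omega), add_zero]⟩
    | smul c w h =>
      obtain ⟨N, hN⟩ := h
      exact ⟨N, fun m hm => by
        rw [smul_comm, hN m hm]; exact smul_zero (A := S A P) c⟩
  | zero => exact ⟨0, fun m _ => by rw [gen_zero, zero_smul]⟩
  | add u v h h' =>
    obtain ⟨N, hN⟩ := h
    obtain ⟨N', hN'⟩ := h'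
    exact ⟨max N N', fun m hm => by
      rw [gen_add, add_smul, hN m (by omega), hN' m (by omega), add_zero]⟩

variable (A P)

/-- The action of `u(m)` on `S(M)`. -/
def genAction (m : ℤ) : V →ₗ[ℂ] Module.End ℂ (S A P) :=
  (Algebra.lsmul ℂ ℂ (S A P)).toLinearMap ∘ₗ genLin m

theorem genAction_apply (m : ℤ) (u : V) (w : S A P) : genAction A P m u w = gen u m • w := rfl

/-- The vertex operator map `Y_{S(M)}`. -/
def YS : V →ₗ[ℂ] VertexOperator ℂ (S A P) :=
  ofModes (genAction A P) fun u w => by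
    simpa only [genAction_apply] using gen_smul_eq_zero_of_large u w

theorem mode_YS (u : V) (m : ℤ) (w : S A P) : mode (YS A P) u m w = gen u m • w := by
  rw [YS, mode_ofModes, genAction_apply]

end Quotient

/-! ### Additivity of the defect, for reduction to homogeneous vectors -/

section Additivity

variable {W : Type*} [AddCommGroup W]

theorem binSum_add (r : ℤ) {f g : ℕ → W} (hf : ∃ N, ∀ i, N ≤ i → f i = 0)
    (hg : ∃ N, ∀ i, N ≤ i → g i = 0) :
    binSum r (fun i => f i + g i) = binSum r f + binSum r g := by
  obtain ⟨N, hN⟩ := hf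
  obtain ⟨N', hN'⟩ := hg
  rw [binSum_eq_sum (N := max N N') _ fun i hi => hN i (by omega),
    binSum_eq_sum (N := max N N') _ fun i hi => hN' i (by omega),
    binSum_eq_sum (N := max N N') _ fun i hi => by
      rw [hN i (by omega), hN' i (by omega), add_zero], ← Finset.sum_add_distrib]
  simp only [smul_add]

variable {V : Type*} [AddCommGroup V] [Module ℂ V] [Module ℂ W]
variable (Y : V →ₗ[ℂ] VertexOperator ℂ V) (YW : V →ₗ[ℂ] VertexOperator ℂ W)

theorem mode_add (u v : V) (n : ℤ) (w : W) :
    mode YW (u + v) n w = mode YW u n w + mode YW v n w :=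
  map_add (modeAt YW n w) u v

theorem mode_zero (n : ℤ) (w : W) : mode YW 0 n w = 0 := map_zero (modeAt YW n w)

theorem productSum_finite (u v : V) (w : W) (l m n : ℤ) :
    ∃ N : ℕ, ∀ i, N ≤ i →
      (-1 : ℤ) ^ i • mode YW u (m + l - i) (mode YW v (n + i) w) = 0 := by
  obtain ⟨N, hN⟩ := mode_eq_zero_of_large YW v w
  exact ⟨(N - n).toNat, fun i hi => by rw [hN _ (by omega), map_zero, smul_zero]⟩

theorem iterateSum_finite (u v : V) (w : W) (l m n : ℤ) :
    ∃ N : ℕ, ∀ i, N ≤ i → mode YW (mode Y u (l + i) v) (m + n - i) w = 0 := by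
  obtain ⟨N, hN⟩ := mode_eq_zero_of_large Y u v
  exact ⟨(N - l).toNat, fun i hi => by rw [hN _ (by omega), mode_zero]⟩

theorem jacobiDefect_add_left (u u' v : V) (w : W) (l m n : ℤ) :
    jacobiDefect Y YW (u + u') v w l m n =
      jacobiDefect Y YW u v w l m n + jacobiDefect Y YW u' v w l m n := by
  simp only [jacobiDefect, productSum, iterateSum, mode_add, map_add, smul_add]
  rw [binSum_add _ (productSum_finite YW u v w l m n) (productSum_finite YW u' v w l m n),
    binSum_add _ (productSum_finite YW v u w l n m) (productSum_finite YW v u' w l n m),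
    binSum_add _ (iterateSum_finite Y YW u v w l m n) (iterateSum_finite Y YW u' v w l m n), smul_add]
  abel

theorem jacobiDefect_add_middle (u v v' : V) (w : W) (l m n : ℤ) :
    jacobiDefect Y YW u (v + v') w l m n =
      jacobiDefect Y YW u v w l m n + jacobiDefect Y YW u v' w l m n := by
  simp only [jacobiDefect, productSum, iterateSum, mode_add, map_add, smul_add]
  rw [binSum_add _ (productSum_finite YW u v w l m n) (productSum_finite YW u v' w l m n),
    binSum_add _ (productSum_finite YW v u w l n m) (productSum_finite YW v' u w l n m),
    binSum_add _ (iterateSum_finite Y YW u v w l m n) (iterateSum_finite Y YW u v' w l m n), smul_add]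
  abel

theorem jacobiDefect_add_right (u v : V) (w w' : W) (l m n : ℤ) :
    jacobiDefect Y YW u v (w + w') l m n =
      jacobiDefect Y YW u v w l m n + jacobiDefect Y YW u v w' l m n := by
  simp only [jacobiDefect, productSum, iterateSum, map_add, smul_add]
  rw [binSum_add _ (productSum_finite YW u v w l m n) (productSum_finite YW u v w' l m n),
    binSum_add _ (productSum_finite YW v u w l n m) (productSum_finite YW v u w' l n m),
    binSum_add _ (iterateSum_finite Y YW u v w l m n) (iterateSum_finite Y YW u v w' l m n), smul_add]
  abel

theorem jacobiDefect_zero_left (v : V) (w : W) (l m n : ℤ) :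
    jacobiDefect Y YW 0 v w l m n = 0 := by
  simpa using jacobiDefect_add_left Y YW 0 0 v w l m n

theorem jacobiDefect_zero_middle (u : V) (w : W) (l m n : ℤ) :
    jacobiDefect Y YW u 0 w l m n = 0 := by
  simpa using jacobiDefect_add_middle Y YW u 0 0 w l m n

theorem jacobiDefect_zero_right (u v : V) (l m n : ℤ) :
    jacobiDefect Y YW u v 0 l m n = 0 := by
  simpa using jacobiDefect_add_right Y YW u v 0 0 l m n

end Additivity

/-! ### Weak associativity and the vacuum in `S(M)` -/

section Relations

variable {V : Type*} [AddCommGroup V] [Module ℂ V] {M : Type*} [AddCommGroup M] [Module ℂ M]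
variable {A : NGradedVertexAlgebra V} {P : ZhuModule A M}

/-- The coefficients of `(x₀ + x₂)^l Y(Y(u, x₀)v, x₂)w`. -/
def assocIterate (A : NGradedVertexAlgebra V) {P : ZhuModule A M} (u v : V) (w : S A P)
    (l x y : ℤ) : S A P :=
  binSum l fun j => gen (mode A.Y u (x + j) v) (y + l - j) • w

theorem assocIterate_eq_sum (u v : V) (w : S A P) {l : ℤ} (hl : 0 ≤ l) (x y : ℤ) :
    assocIterate A u v w l x y = ∑ j ∈ Finset.range (l + 1).toNat,
      Ring.choose l j • (gen (mode A.Y u (x + j) v) (y + l - j) • w) := by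
  apply finsum_eq_sum_of_support_subset
  intro j hj
  rw [Function.mem_support] at hj
  by_contra hn
  simp only [Finset.coe_range, Set.mem_Iio, not_lt] at hn
  apply hj
  obtain ⟨l, rfl⟩ := Int.eq_ofNat_of_zero_le hl
  rw [Ring.choose_natCast, Nat.choose_eq_zero_of_lt (by omega), Nat.cast_zero, zero_smul]

/-- Weak associativity without the side conditions of the third family of generators. If `q ≥ b +
d`, then `v(q)w = 0` and `𝓙` kills the right side; if the total degree is negative, both sides
vanish; otherwise `𝓙` lets the finite sum over `i` run to infinity. -/
theorem gen_smul_gen_smul_eq_binSum {a b d : ℤ} {u v : V} {w : S A P} (hu : u ∈ A.wt a)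
    (hv : v ∈ A.wt b) (hw : w ∈ degSInt A P d) (hl : 0 ≤ a + d) (p q : ℤ) :
    gen u (p + (a + d)) • gen v q • w =
      binSum p fun i => assocIterate A u v w (a + d) (p - i) (q + i) := by
  have hG : ∀ x y, b + d ≤ y → assocIterate A u v w (a + d) x y = 0 := fun x y hy => by
    rw [assocIterate_eq_sum _ _ _ hl]
    exact sum_gen_smul_eq_zero hu hv hw hy
  rcases le_or_gt (b + d) q with hq | hq
  · rw [gen_smul_eq_zero hv hw (by omega), smul_zero, binSum_eq_zero]
    intro i
    exact hG _ _ (by omega)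
  rcases lt_or_ge ((a - (p + (a + d)) - 1) + (b - q - 1) + d) 0 with hd | hd
  · rw [gen_smul_eq_zero hu (gen_smul_mem_degSInt hv hw) (by omega), binSum_eq_zero]
    intro i
    refine binSum_eq_zero _ fun j => ?_
    exact gen_smul_eq_zero (A.mode_mem a b (p - i + j) u v hu hv) hw (by omega)
  · rw [gen_smul_gen_smul hu hv hw hq hd, binSum_eq_sum (N := (b + d - q).toNat)]
    · refine Finset.sum_congr rfl fun i _ => ?_
      rw [assocIterate_eq_sum _ _ _ hl, Finset.smul_sum]
      refine Finset.sum_congr rfl fun j _ => ?_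
      rw [add_sub_cancel_right, smul_smul, show q + (a + d) + i - j = q + i + (a + d) - j by ring]
    · intro i hi
      exact hG _ _ (by omega)

/-- At `m = a + d` this is the inverted form of `gen_smul_gen_smul_eq_binSum`; the recursion, solved
for its `m + 1` term, carries it upwards. -/
theorem jacobiDefect_YS_homogeneous {a b d : ℤ} {u v : V} {w : S A P} (hu : u ∈ A.wt a)
    (hv : v ∈ A.wt b) (hw : w ∈ degSInt A P d) (hl : 0 ≤ a + d) (l m n : ℤ) (hm : a + d ≤ m) :
    jacobiDefect A.Y (YS A P) u v w l m n = 0 := by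
  induction m, hm using Int.leInduction generalizing l n with
  | base =>
    have h1 : productSum (YS A P) u v w l (a + d) n = assocIterate A u v w (a + d) l n := by
      have hinv := binSum_inversion (F := fun p q => gen u (p + (a + d)) • gen v q • w)
        (G := assocIterate A u v w (a + d)) (K := b + d)
        (fun x y hy => by
          rw [assocIterate_eq_sum _ _ _ hl]
          exact sum_gen_smul_eq_zero hu hv hw hy)
        (gen_smul_gen_smul_eq_binSum hu hv hw hl) l n
      rw [← hinv, productSum]
      simp only [mode_YS]
      congr 1
      funext i
      rw [show l - i + (a + d) = a + d + l - i by ring]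
    have h2 : productSum (YS A P) v u w l n (a + d) = 0 := binSum_eq_zero _ fun i => by
      rw [mode_YS, mode_YS, gen_smul_eq_zero hu hw (by omega), smul_zero]
      exact smul_zero (A := S A P) _
    have h3 : iterateSum A.Y (YS A P) u v w l (a + d) n = assocIterate A u v w (a + d) l n := by
      simp only [iterateSum, assocIterate, mode_YS, add_comm n]
    rw [jacobiDefect, h1, h2, h3, smul_zero, sub_zero, sub_self]
  | succ m _ ih =>
    have := jacobiDefect_recursion A.Y (YS A P) u v w l m n
    rw [ih, ih, sub_zero] at this
    exact this.symm

/-- Weights in `V` and degrees in `S(M)` are nonnegative, so for nonzero homogeneous vectors `a + d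
≥ 0`. The bound does not depend on `l` and `n`, so a sum of vectors takes the larger of two bounds.
-/
theorem jacobiDefect_YS_eventually (u v : V) (w : S A P) :
    ∃ k, ∀ l m n, k ≤ m → jacobiDefect A.Y (YS A P) u v w l m n = 0 := by
  suffices hhom : ∀ d, ∀ w ∈ degSInt A P d,
      ∃ k, ∀ l m n, k ≤ m → jacobiDefect A.Y (YS A P) u v w l m n = 0 by
    obtain ⟨x, rfl⟩ := mkS_surjective A P w
    have hx : x ∈ Submodule.span ℂ {x : FreeMod V M | ∃ d, IsMonomial A d x} := by
      rw [span_isMonomial]; trivial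
    have hx' : x ∈ ⨆ d, degFree A M d := by
      refine Submodule.span_le.2 ?_ hx
      rintro x ⟨d, hd⟩
      exact Submodule.mem_iSup_of_mem d (isMonomial_mem_degFree A hd)
    refine Submodule.iSup_induction _ (motive := fun x => ∃ k, ∀ l m n, k ≤ m →
      jacobiDefect A.Y (YS A P) u v (mkS A P x) l m n = 0) hx'
      (fun d x hx => hhom d _ ⟨x, hx, rfl⟩) ?_ ?_
    · exact ⟨0, fun l m n _ => by rw [map_zero, jacobiDefect_zero_right]⟩
    · rintro x y ⟨k, hk⟩ ⟨k', hk'⟩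
      exact ⟨max k k', fun l m n hm => by
        rw [map_add, jacobiDefect_add_right, hk _ _ _ (by omega), hk' _ _ _ (by omega), add_zero]⟩
  intro d w hw
  rcases lt_or_ge d 0 with hd | hd
  · rw [degSInt_of_neg hd, Submodule.mem_bot] at hw
    exact ⟨0, fun l m n _ => by rw [hw, jacobiDefect_zero_right]⟩
  induction u using homogeneous_induction A with
  | zero => exact ⟨0, fun l m n _ => jacobiDefect_zero_left _ _ _ _ _ _ _⟩
  | add u u' h h' =>
    obtain ⟨k, hk⟩ := h
    obtain ⟨k', hk'⟩ := h'
    exact ⟨max k k', fun l m n hm => by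
      rw [jacobiDefect_add_left, hk _ _ _ (by omega), hk' _ _ _ (by omega), add_zero]⟩
  | hom a u hu =>
    rcases lt_or_ge a 0 with ha | ha
    · rw [A.wt_neg a ha, Submodule.mem_bot] at hu
      exact ⟨0, fun l m n _ => by rw [hu, jacobiDefect_zero_left]⟩
    induction v using homogeneous_induction A with
    | zero => exact ⟨0, fun l m n _ => jacobiDefect_zero_middle _ _ _ _ _ _ _⟩
    | add v v' h h' =>
      obtain ⟨k, hk⟩ := h
      obtain ⟨k', hk'⟩ := h'
      exact ⟨max k k', fun l m n hm => by
        rw [jacobiDefect_add_middle, hk _ _ _ (by omega), hk' _ _ _ (by omega), add_zero]⟩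
    | hom b v hv =>
      exact ⟨a + d, fun l m n hm => jacobiDefect_YS_homogeneous hu hv hw (by omega) l m n hm⟩

/-- In the product relation only the terms with `𝟏_{-1}u = u` survive. With `p = s - 1` they are all
multiples of `u(q+s)w`, with total coefficient `(s-1) choose s`, which is `1` for `s = 0` and `0`
for `s > 0`. -/
theorem vac_smul_gen_smul {k d q : ℤ} {u : V} {w : S A P} (hu : u ∈ A.wt k)
    (hw : w ∈ degSInt A P d) (p : ℤ) :
    gen A.vac p • gen u q • w = if p = -1 then gen u q • w else 0 := by
  have hvac := vac_mem_wt_zero A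
  rcases lt_or_ge d 0 with hd | hd
  · rw [degSInt_of_neg hd, Submodule.mem_bot] at hw
    simp [hw]
  rcases le_or_gt (k + d) q with hq | hq
  · rw [gen_smul_eq_zero hu hw (by omega)]
    simp
  rcases lt_or_ge ((0 - p - 1) + (k - q - 1) + d) 0 with hneg | hneg
  · rw [gen_smul_eq_zero hvac (gen_smul_mem_degSInt hu hw) (by omega)]
    split_ifs with hp
    · rw [gen_smul_eq_zero hu hw (by omega)]
    · rfl
  rw [gen_smul_gen_smul hvac hu hw hq hneg]
  obtain ⟨d, rfl⟩ := Int.eq_ofNat_of_zero_le hd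
  simp only [zero_add, A.vacuum]
  -- For `p < -1` and `j ≤ d` the vacuum index `p - d - i + j` stays below `-1`.
  rcases lt_or_ge p (-1) with hp | hp
  · rw [if_neg (by omega), Finset.sum_eq_zero]
    intro i _
    refine Finset.sum_eq_zero fun j hj => ?_
    rw [Finset.mem_range] at hj
    rw [if_neg (by omega), gen_zero, zero_smul]
    exact smul_zero (A := S A P) _
  obtain ⟨s, rfl⟩ : ∃ s : ℕ, p = s - 1 := ⟨(p + 1).toNat, by omega⟩
  have hinner : ∀ i : ℕ, ∑ j ∈ Finset.range ((d : ℤ) + 1).toNat,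
      (Ring.choose ((s : ℤ) - 1 - d) i * Ring.choose (d : ℤ) j) •
        gen (if (s : ℤ) - 1 - d - i + j = -1 then u else 0) (q + d + i - j) • w =
      (if i ≤ s then Ring.choose ((s : ℤ) - 1 - d) i * Ring.choose (d : ℤ) (s - i) else 0) •
        gen u (q + s) • w := by
    intro i
    by_cases hi : i ≤ s ∧ s - i ≤ d
    · rw [if_pos hi.1, Finset.sum_eq_single (d - (s - i)), if_pos (by omega)]
      · rw [Ring.choose_natCast, Ring.choose_natCast, Nat.choose_symm hi.2]
        congr 3
        omega
      · intro j _ hj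
        rw [if_neg (by omega), gen_zero, zero_smul]
        exact smul_zero (A := S A P) _
      · intro h
        exact absurd (Finset.mem_range.2 (by omega)) h
    · rw [Finset.sum_eq_zero]
      · split_ifs with his
        · rw [Ring.choose_natCast, Nat.choose_eq_zero_of_lt (by omega), Nat.cast_zero, mul_zero,
            zero_smul]
        · rw [zero_smul]
      · intro j hj
        rw [Finset.mem_range] at hj
        rw [if_neg (by omega), gen_zero, zero_smul]
        exact smul_zero (A := S A P) _
  rw [Finset.sum_congr rfl fun i _ => hinner i, ← Finset.sum_smul]
  rcases le_or_gt (k + d) (q + s) with hs | hs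
  · rw [gen_smul_eq_zero hu hw (by omega), if_neg (by omega)]
    exact smul_zero (A := S A P) _
  -- Since `q + s < k + d`, the range contains every `i ≤ s`, and the sum is a complete Vandermonde
  -- convolution.
  · have hvand : ∑ i ∈ Finset.range (k + d - q).toNat,
        (if i ≤ s then Ring.choose ((s : ℤ) - 1 - d) i * Ring.choose (d : ℤ) (s - i) else 0) =
        Ring.choose ((s : ℤ) - 1) s := by
      have h := Ring.add_choose_eq s (Commute.all ((s : ℤ) - 1 - d) (d : ℤ))
      rw [sub_add_cancel] at h
      rw [h, Finset.Nat.sum_antidiagonal_eq_sum_range_succ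
        (fun i j => Ring.choose ((s : ℤ) - 1 - d) i * Ring.choose (d : ℤ) j),
        ← Finset.sum_filter]
      refine Finset.sum_congr ?_ fun _ _ => rfl
      ext i
      simp only [Finset.mem_filter, Finset.mem_range]
      omega
    rw [hvand]
    rcases s with _ | s
    · simp
    · rw [if_neg (by push_cast; omega),
        show ((s + 1 : ℕ) : ℤ) - 1 = (s : ℤ) by push_cast; ring, Ring.choose_natCast,
        Nat.choose_succ_self, Nat.cast_zero, zero_smul]

theorem vac_smul_ofM (x : M) (p : ℤ) :
    gen A.vac p • mkS A P (ofM V x) = if p = -1 then mkS A P (ofM V x) else 0 := by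
  have h : gen A.vac (-1) • mkS A P (ofM V x) = mkS A P (ofM V x) := by
    have := oT_smul (A := A) (P := P) A.vac x
    rwa [oT_apply A (vac_mem_wt_zero A), P.ρ_one, zero_sub, Module.End.one_apply] at this
  have := vac_smul_gen_smul (P := P) (q := -1) (vac_mem_wt_zero A)
    (mkS_mem_degSInt (IsMonomial.base x)) p
  rwa [h] at this

theorem vac_smul (p : ℤ) (w : S A P) : gen A.vac p • w = if p = -1 then w else 0 := by
  induction w using monomial_induction with
  | mono d x hx =>
    cases hx with
    | base x => exact vac_smul_ofM x p
    | act k m d u x hu hx =>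
      rw [map_smul]
      exact vac_smul_gen_smul hu (mkS_mem_degSInt hx) p
  | zero => simp
  | add w w' h h' => rw [smul_add, h, h']; split_ifs <;> simp
  | smul c w h =>
    rw [smul_comm, h]
    split_ifs
    · rfl
    · exact smul_zero (A := S A P) c

end Relations

/-! ### Directness of the grading, by the operator `2^deg` -/

section Grading

variable {V : Type*} [AddCommGroup V] [Module ℂ V] {M : Type*} [AddCommGroup M] [Module ℂ M]
variable (A : NGradedVertexAlgebra V)

/-- The operator `2^{L(0)}` on `V`. -/
def weightScale : V →ₗ[ℂ] V := linearExtend A fun m => (2 : ℂ) ^ m • (A.wt m).subtype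

theorem weightScale_apply {a : ℤ} {u : V} (hu : u ∈ A.wt a) :
    weightScale A u = (2 : ℂ) ^ a • u :=
  linearExtend_apply A (fun m => (2 : ℂ) ^ m • (A.wt m).subtype) a ⟨u, hu⟩

/-- The substitution `t ↦ t / 2` of Laurent polynomials. -/
def laurentScale : LaurentPolynomial ℂ →ₐ[ℂ] LaurentPolynomial ℂ :=
  AddMonoidAlgebra.lift ℂ (LaurentPolynomial ℂ) ℤ
    { toFun := fun n => (2 : ℂ) ^ (-n.toAdd) • LaurentPolynomial.T n.toAdd
      map_one' := by simp
      map_mul' := fun m n => by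
        rw [toAdd_mul, LaurentPolynomial.T_add, smul_mul_smul_comm, neg_add, zpow_add₀ two_ne_zero] }

theorem laurentScale_T (n : ℤ) :
    laurentScale (LaurentPolynomial.T n) = (2 : ℂ) ^ (-n) • LaurentPolynomial.T n := by
  rw [laurentScale, LaurentPolynomial.T, AddMonoidAlgebra.lift_single, one_smul]
  rfl

/-- The automorphism of `T(V[t, t⁻¹])` that scales `u(m)` by `2 ^ (wt u - m - 1)`. -/
def degreeScaleAlg : AffTensor V →ₐ[ℂ] AffTensor V :=
  TensorAlgebra.lift ℂ (TensorAlgebra.ι ℂ ∘ₗ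
    -- The factor `2⁻¹` accounts for the `-1` in `wt u - m - 1`.
    ((2 : ℂ)⁻¹ • TensorProduct.map (weightScale A) laurentScale.toLinearMap))

theorem degreeScaleAlg_gen {a : ℤ} {u : V} (hu : u ∈ A.wt a) (m : ℤ) :
    degreeScaleAlg A (gen u m) = (2 : ℂ) ^ (a - m - 1) • gen u m := by
  rw [degreeScaleAlg, gen, TensorAlgebra.lift_ι_apply, LinearMap.comp_apply, LinearMap.smul_apply,
    TensorProduct.map_tmul, weightScale_apply A hu, AlgHom.toLinearMap_apply, laurentScale_T,
    TensorProduct.smul_tmul_smul, smul_smul, map_smul]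
  congr 1
  rw [zpow_sub_one₀ two_ne_zero, sub_eq_add_neg, zpow_add₀ two_ne_zero]
  ring

theorem degreeScaleAlg_oT (u : V) : degreeScaleAlg A (oT A u) = oT A u := by
  induction u using homogeneous_induction A with
  | hom a u hu => rw [oT_apply A hu, degreeScaleAlg_gen A hu]; simp
  | zero => simp only [map_zero]
  | add u v hu hv => simp only [map_add, hu, hv]

/-- The operator on `T(V[t, t⁻¹]) ⊗ M` that multiplies elements of degree `d` by `2 ^ d`. -/
def degreeScale (M : Type*) [AddCommGroup M] [Module ℂ M] :
    FreeMod V M →ₛₗ[(degreeScaleAlg A).toRingHom] FreeMod V M where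
  toFun := TensorProduct.map (degreeScaleAlg A).toLinearMap LinearMap.id
  map_add' := map_add _
  map_smul' t x := by
    induction x using TensorProduct.induction_on with
    | zero => simp only [smul_zero, map_zero]
    | add x y hx hy => simp only [smul_add, map_add, hx, hy]
    | tmul s w =>
      simp only [TensorProduct.smul_tmul', smul_eq_mul, TensorProduct.map_tmul,
        AlgHom.toLinearMap_apply, map_mul]
      rfl

theorem degreeScale_ofM (w : M) : degreeScale A M (ofM V w) = ofM V w := by
  change TensorProduct.map _ _ _ = _
  rw [ofM, TensorProduct.map_tmul]
  simp

theorem degreeScale_smul (c : ℂ) (x : FreeMod V M) :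
    degreeScale A M (c • x) = c • degreeScale A M x :=
  map_smul (TensorProduct.map (degreeScaleAlg A).toLinearMap LinearMap.id) c x

theorem degreeScale_apply {d : ℤ} {x : FreeMod V M} (hx : x ∈ degFree A M d) :
    degreeScale A M x = (2 : ℂ) ^ d • x := by
  induction hx using Submodule.span_induction with
  | mem x hx =>
    change IsMonomial A d x at hx
    induction hx with
    | base w => rw [degreeScale_ofM, zpow_zero, one_smul]
    | act k m d u x hu hx ih =>
      rw [LinearMap.map_smulₛₗ, ih]
      change degreeScaleAlg A (gen u m) • _ = _
      rw [degreeScaleAlg_gen A hu, smul_assoc, smul_comm (gen u m), smul_smul,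
        ← zpow_add₀ two_ne_zero]
  | zero => rw [map_zero, smul_zero]
  | add x y _ _ hx hy => rw [map_add, hx, hy, smul_add]
  | smul c x _ hx => rw [degreeScale_smul, hx, smul_comm]

theorem productRelation_mem_degFree {a b d p q : ℤ} {u v : V} {w : FreeMod V M} (hu : u ∈ A.wt a)
    (hv : v ∈ A.wt b) (hw : w ∈ degFree A M d) (k l : ℤ) :
    productRelation A u v k l p q w ∈ degFree A M ((a - p - 1) + ((b - q - 1) + d)) := by
  refine sub_mem (gen_smul_mem_degFree A hu (gen_smul_mem_degFree A hv hw))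
    (sum_mem fun i _ => sum_mem fun j _ => zsmul_mem ?_ _)
  convert gen_smul_mem_degFree A (A.mode_mem a b (p - l - i + j) u v hu hv) hw using 2
  ring

variable (P : ZhuModule A M)

/-- It suffices to test generators. Those of the first and third kind are homogeneous, hence
eigenvectors of the scaling; those of the second kind have degree `0` and are fixed. -/
theorem relI_le_comap : relI A P ≤ (relI A P).comap (degreeScale A M) := by
  have hsmul : ∀ (c : ℂ), ∀ x ∈ relI A P, c • x ∈ relI A P := fun c x hx =>
    ((relI A P).restrictScalars ℂ).smul_mem c hx
  refine Submodule.span_le.2 fun x hx => ?_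
  rw [SetLike.mem_coe, Submodule.mem_comap]
  have hx' : x ∈ relI A P := Submodule.subset_span hx
  rcases hx with (⟨a, d, m, u, w, hu, hw, -, rfl⟩ | ⟨u, w, rfl⟩) |
    ⟨a, b, d, p, q, u, v, w, hu, hv, hw, -, -, rfl⟩
  · rw [degreeScale_apply A (gen_smul_mem_degFree A hu hw)]
    exact hsmul _ _ hx'
  · rw [map_sub, LinearMap.map_smulₛₗ, degreeScale_ofM, degreeScale_ofM]
    change degreeScaleAlg A (oT A u) • _ - _ ∈ _
    rwa [degreeScaleAlg_oT]
  · rw [degreeScale_apply A (productRelation_mem_degFree A hu hv hw _ _)]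
    exact hsmul _ _ hx'

/-- The operator on `S₁(M)` that multiplies elements of degree `d` by `2 ^ d`. -/
def degreeScaleS1 : S1 A P →ₛₗ[(degreeScaleAlg A).toRingHom] S1 A P :=
  (relI A P).mapQ (relI A P) (degreeScale A M) (relI_le_comap A P)

theorem degreeScaleS1_mkQ (x : FreeMod V M) :
    degreeScaleS1 A P ((relI A P).mkQ x) = (relI A P).mkQ (degreeScale A M x) := rfl

theorem degreeScaleS1_apply {d : ℤ} {w : S1 A P} (hw : w ∈ degS1 A P d) :
    degreeScaleS1 A P w = (2 : ℂ) ^ d • w := by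
  obtain ⟨x, hx, rfl⟩ := hw
  rw [LinearMap.restrictScalars_apply, degreeScaleS1_mkQ, degreeScale_apply A hx]
  rfl

theorem truncationRelation_mem_degS1 {a b d : ℤ} {u v : V} {w : S1 A P} (hu : u ∈ A.wt a)
    (hv : v ∈ A.wt b) (hw : w ∈ degS1 A P d) (l p q i : ℤ) :
    truncationRelation A P u v l p q i w ∈ degS1 A P ((a - p - 1) + ((b - q - 1) + d)) := by
  obtain ⟨x, hx, rfl⟩ := hw
  refine sum_mem fun j _ => zsmul_mem ?_ _
  refine ⟨gen (mode A.Y u (p - l - i + j) v) (q + i + l - j) • x, ?_, rfl⟩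
  rw [SetLike.mem_coe]
  convert gen_smul_mem_degFree A (A.mode_mem a b (p - l - i + j) u v hu hv) hx using 2
  ring

theorem relJ_le_comap : relJ A P ≤ (relJ A P).comap (degreeScaleS1 A P) := by
  refine Submodule.span_le.2 fun x hx => ?_
  rw [SetLike.mem_coe, Submodule.mem_comap]
  have hx' : x ∈ relJ A P := Submodule.subset_span hx
  obtain ⟨a, b, d, p, q, i, u, v, w, hu, hv, hw, -, rfl⟩ := hx
  rw [degreeScaleS1_apply A P (truncationRelation_mem_degS1 A P hu hv hw _ _ _ _)]
  exact ((relJ A P).restrictScalars ℂ).smul_mem _ hx'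

/-- The operator on `S(M)` that multiplies elements of degree `d` by `2 ^ d`, as a semilinear map. -/
def degreeScaleSemilinear : S A P →ₛₗ[(degreeScaleAlg A).toRingHom] S A P :=
  (relJ A P).mapQ (relJ A P) (degreeScaleS1 A P) (relJ_le_comap A P)

theorem degreeScaleSemilinear_mkS (x : FreeMod V M) :
    degreeScaleSemilinear A P (mkS A P x) = mkS A P (degreeScale A M x) := rfl

/-- The operator on `S(M)` that multiplies elements of degree `d` by `2 ^ d`. -/
def degreeScaleS : Module.End ℂ (S A P) where
  toFun := degreeScaleSemilinear A P
  map_add' := map_add _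
  map_smul' c w := by
    rw [← algebraMap_smul (AffTensor V) c w, LinearMap.map_smulₛₗ]
    change degreeScaleAlg A (algebraMap ℂ (AffTensor V) c) • _ = _
    rw [AlgHom.commutes, algebraMap_smul]
    rfl

theorem degSInt_le_eigenspace (d : ℤ) :
    degSInt A P d ≤ Module.End.eigenspace (degreeScaleS A P) ((2 : ℂ) ^ d) := by
  rintro _ ⟨x, hx, rfl⟩
  rw [Module.End.mem_eigenspace_iff]
  change degreeScaleSemilinear A P (mkS A P x) = _
  rw [degreeScaleSemilinear_mkS, degreeScale_apply A hx]
  rfl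

/-- Eigenspaces for distinct eigenvalues are independent, and the powers `2^n` are distinct. -/
theorem iSupIndep_degS : iSupIndep (degS A P) := by
  have hinj : Function.Injective fun n : ℕ => (2 : ℂ) ^ n := by
    intro m n h
    simp only at h
    have h' : (2 : ℕ) ^ m = 2 ^ n := by exact_mod_cast h
    exact Nat.pow_right_injective le_rfl h'
  refine ((Module.End.eigenspaces_iSupIndep (degreeScaleS A P)).comp hinj).mono fun n => ?_
  rw [degS_eq]
  simpa using degSInt_le_eigenspace A P n

theorem iSup_degS : ⨆ n, degS A P n = ⊤ := by
  rw [eq_top_iff]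
  rintro w -
  induction w using monomial_induction with
  | mono d x hx =>
    rcases lt_or_ge d 0 with hd | hd
    · rw [mkS_isMonomial_of_neg hx hd]; exact zero_mem _
    · obtain ⟨n, rfl⟩ := Int.eq_ofNat_of_zero_le hd
      refine Submodule.mem_iSup_of_mem n ?_
      rw [degS_eq]
      exact mkS_mem_degSInt hx
  | zero => exact zero_mem _
  | add w w' h h' => exact add_mem h h'
  | smul c w h => exact Submodule.smul_mem _ c h

theorem isInternal_degS : DirectSum.IsInternal (degS A P) :=
  DirectSum.isInternal_submodule_of_iSupIndep_of_iSup_eq_top (iSupIndep_degS A P) (iSup_degS A P)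

end Grading

end VA

end

/-! ### The module structure on `S(M)` -/

theorem theorem4p1 {V : Type*} [AddCommGroup V] [Module ℂ V] (A : VA.NGradedVertexAlgebra V)
    {M : Type*} [AddCommGroup M] [Module ℂ M] (P : VA.ZhuModule A M) :
    ∃ YS : V →ₗ[ℂ] VertexOperator ℂ (VA.S A P),
      (∀ (u : V) (m : ℤ) (w : VA.S A P), VA.mode YS u m w = VA.gen u m • w) ∧
      VA.IsNGradableWeakModule A YS (VA.degS A P) := by
  have hvac : ∀ (n : ℤ) (w : VA.S A P),
      VA.mode (VA.YS A P) A.vac n w = if n = -1 then w else 0 := fun n w => by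
    rw [VA.mode_YS, VA.vac_smul]
  refine ⟨VA.YS A P, VA.mode_YS A P, ⟨⟨hvac, ?_⟩, VA.isInternal_degS A P, ?_, ?_⟩⟩
  · exact VA.jacobiIdentity_of_eventually A.toVertexAlgebra hvac VA.jacobiDefect_YS_eventually
  · intro m n k j u w hu hw hj
    rw [VA.degS_eq] at hw ⊢
    rw [VA.mode_YS, show (j : ℤ) = m - n - 1 + k by omega]
    exact VA.gen_smul_mem_degSInt hu hw
  · intro m n k u w hu hw h
    rw [VA.degS_eq] at hw
    rw [VA.mode_YS, VA.gen_smul_eq_zero hu hw (by omega)]
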